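/- Let $D\ge 1$ be an integer, $E_0,\dots,E_D\in\mathbb{R}$ and $\beta\in\mathbb{R}$. A (finite or infinite) plane tree with branching bounded by $D$ (every vertex has at most $D$ children) is coded as follows. Let $r_n\le D^n$ be the number of vertices at distance $n$ from the root (level $n$), and number the vertices of each level $1,\dots,r_n$ in their natural order. For $n\ge1$ let $g_{n,l}$ be the number of the parent of the $l$-th vertex of level $n$ if $1\le l\le r_n$, and $g_{n,l}=0$ if $r_n<l\le D^n$. The sequence of levels $(g_{n,\cdot})_{n\ge1}$ identifies the set $\mathbb{T}$ of all plane trees, finite or infinite, with branching bounded by $D$ with a subset of $\mathbb{X}=\prod_{n\ge1}\{0,1,\dots,D^{n-1}\}^{D^n}$; equip $\mathbb{T}$ with the trace of the product $\sigma$-algebra. For $n\ge 1$ and $T\in\mathbb{T}$ let $\pi_nT\in\mathbb{T}$ be the subtree of $T$ spanned by the vertices at distance at most $n$ from the root, let $S_n\subset\mathbb{T}$ be the set of trees of height exactly $n$, and let $S_\infty\subset\mathbb{T}$ be the set of infinite trees. For $N\ge1$ let $\mu_N$ be the Gibbs distribution on the set $\mathbb{T}_N\subset\mathbb{T}$ of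 trees with $N$ vertices, $$\mu_N\{T\}=\frac{e^{-\beta E(T)}}{\sum_{T'\in\mathbb{T}_N}e^{-\beta E(T')}},\qquad E(T)=\sum_{v}E_{\deg v},$$ where $v$ runs over the vertices of $T$ and $\deg v$ is the number of children of $v$. For every $n\ge1$ the measures $\mu_N\pi_n^{-1}$ converge in total variation, as $N\to\infty$, to a measure $P_n$ on $S_n$. There is a unique measure $P_\infty$ on $\mathbb{T}$ that is consistent with the measures $P_n$, i.e. such that $$P_\infty\pi_n^{-1}=P_n\qquad\text{for all } n\ge1 .$$ This measure is concentrated on $S_\infty$: $P_\infty(\mathbb{T}\setminus S_\infty)=0$. -/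

import Mathlib

open MeasureTheory Filter Topology
open scoped ENNReal

noncomputable section

/-- The space `∏_{n ≥ 1} {0, 1, …, D^(n-1)}^(D^n)` of sequences of levels. The entry `x n` is the
vector describing level `n + 1`; the value `0` means that there is no such vertex, and a value
`v ≥ 1` means that the parent is the vertex number `v` of level `n`. -/
abbrev LevelCode (D : ℕ) : Type := (n : ℕ) → Fin (D ^ (n + 1)) → Fin (D ^ n + 1)

/-- The number `r_n` of vertices at level `n`; level `0` consists of the root alone. -/
def LevelCode.levelSize {D : ℕ} (x : LevelCode D) : ℕ → ℕ
  | 0 => 1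
  | n + 1 => (Finset.univ.filter fun l => x n l ≠ 0).card

/-- The sequence of levels `x` is the code of a plane tree with branching bounded by `D`. -/
structure LevelCode.IsPlaneTree {D : ℕ} (x : LevelCode D) : Prop where
  /-- the vertices of a level are numbered `1, …, r_n`; unused coordinates come last -/
  initial : ∀ n, ∀ l l' : Fin (D ^ (n + 1)), l ≤ l' → x n l' ≠ 0 → x n l ≠ 0
  /-- the enumeration of a level is compatible with that of the parents -/
  monotone : ∀ n, ∀ l l' : Fin (D ^ (n + 1)), l ≤ l' → x n l' ≠ 0 → x n l ≤ x n l'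
  /-- the parents are vertices of the preceding level -/
  parent_le : ∀ n, ∀ l : Fin (D ^ (n + 1)), (x n l : ℕ) ≤ x.levelSize n
  /-- every vertex has at most `D` children -/
  branching : ∀ n, ∀ v : ℕ, v ≠ 0 → (Finset.univ.filter fun l => (x n l : ℕ) = v).card ≤ D

/-- The space of all plane trees (finite or infinite) with branching bounded by `D`, as a subset
of the product space of codes, with the trace of the product σ-algebra. -/
abbrev PlaneTree (D : ℕ) : Type := {x : LevelCode D // x.IsPlaneTree}

namespace PlaneTree

variable {D : ℕ}

/-- The vertices of a tree: `⟨n, i⟩` is the vertex number `i + 1` of level `n`. -/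
abbrev Vertex (T : PlaneTree D) : Type := Σ n : ℕ, Fin (T.1.levelSize n)

/-- The height of a vertex, i.e. its distance to the root. -/
def height (T : PlaneTree D) (v : T.Vertex) : ℕ := v.1

/-- The branching number (number of children) of a vertex. -/
def deg (T : PlaneTree D) (v : T.Vertex) : Fin (D + 1) :=
  ⟨(Finset.univ.filter fun l => (T.1 v.1 l : ℕ) = (v.2 : ℕ) + 1).card,
    Nat.lt_succ_of_le (T.2.branching v.1 _ (Nat.succ_ne_zero _))⟩

/-- The energy of a finite tree. -/
def energy (E : Fin (D + 1) → ℝ) (T : PlaneTree D) : ℝ := ∑ᶠ v : T.Vertex, E (T.deg v)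

/-- The trees with exactly `N` vertices. -/
def ofOrder (D N : ℕ) : Set (PlaneTree D) := {T | ENat.card T.Vertex = N}

/-- The trees of height exactly `n`. -/
def ofHeight (D n : ℕ) : Set (PlaneTree D) := {T | IsGreatest (Set.range T.height) n}

/-- The infinite trees. -/
def infinite (D : ℕ) : Set (PlaneTree D) := {T | Infinite T.Vertex}

theorem levelSize_trunc (n : ℕ) (x : LevelCode D) {m : ℕ} (hm : m ≤ n) :
    LevelCode.levelSize (fun j l => if j < n then x j l else 0) m = x.levelSize m := by
  cases m with
  | zero => rfl
  | succ k =>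
    have hk : k < n := hm
    simp [LevelCode.levelSize, hk]

/-- The neighbourhood of the root of radius `n`: the subtree spanned by the vertices of height at
most `n`. -/
def truncate (n : ℕ) (T : PlaneTree D) : PlaneTree D :=
  ⟨fun m l => if m < n then T.1 m l else 0, by
    refine ⟨fun m l l' h h' => ?_, fun m l l' h h' => ?_, fun m l => ?_, fun m v hv => ?_⟩ <;>
      by_cases hm : m < n
    · simp only [hm, if_true] at h' ⊢
      exact T.2.initial m l l' h h'
    · simp [hm] at h'
    · simp only [hm, if_true] at h' ⊢
      exact T.2.monotone m l l' h h'
    · simp [hm]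
    · rw [levelSize_trunc n T.1 hm.le]
      simpa [hm] using T.2.parent_le m l
    · simp [hm]
    · simpa [hm] using T.2.branching m v hv
    · simp [hm, hv.symm]⟩

theorem measurable_truncate (n : ℕ) : Measurable (truncate n : PlaneTree D → PlaneTree D) := by
  refine Measurable.subtype_mk (measurable_pi_lambda _ fun m => measurable_pi_lambda _ fun l => ?_)
  by_cases hm : m < n
  · simp only [hm, if_true]
    exact (measurable_pi_apply l).comp ((measurable_pi_apply m).comp measurable_subtype_coe)
  · simp [hm]

/-- The partition function on trees with `N` vertices. -/
def partitionFunction (E : Fin (D + 1) → ℝ) (β : ℝ) (N : ℕ) : ℝ :=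
  ∑ᶠ T : ofOrder D N, Real.exp (-β * energy E T.1)

/-- The Gibbs distribution on trees with `N` vertices, as a measure on the space of all trees. -/
def gibbs (E : Fin (D + 1) → ℝ) (β : ℝ) (N : ℕ) : Measure (PlaneTree D) :=
  Measure.sum fun T : ofOrder D N =>
    ENNReal.ofReal (Real.exp (-β * energy E T.1) / partitionFunction E β N) • Measure.dirac T.1

end PlaneTree

/-- The total variation distance `sup_A |μ(A) - ν(A)|`. -/
def tvDist {Ω : Type*} [MeasurableSpace Ω] (μ ν : Measure Ω) : ℝ≥0∞ :=
  ⨆ (A : Set Ω) (_ : MeasurableSet A), max (μ A - ν A) (ν A - μ A)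

/-- A measure `P` on the set of trees of height `n` is the limit in total variation, as `N → ∞`,
of the laws of the radius-`n` neighbourhood of the root under the Gibbs distributions. -/
def IsLimitLaw {D : ℕ} (E : Fin (D + 1) → ℝ) (β : ℝ) (n : ℕ)
    (P : Measure (PlaneTree.ofHeight D n)) : Prop :=
  Tendsto (fun N : ℕ => tvDist ((PlaneTree.gibbs E β N).map (PlaneTree.truncate n))
    (P.map Subtype.val)) atTop (𝓝 0)

/-- The measure `Q` on the space of trees is consistent with the measures `P n`, `n ≥ 1`. -/
def IsConsistent {D : ℕ} (P : (n : ℕ) → Measure (PlaneTree.ofHeight D n))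
    (Q : Measure (PlaneTree D)) : Prop :=
  ∀ n : ℕ, 1 ≤ n → Q.map (PlaneTree.truncate n) = (P n).map Subtype.val

end

noncomputable section

/-! The Gibbs weight is a product over vertices of `w d = exp (-β * E d)`. Fix a neighbourhood `t`
of radius `n`. The trees that extend it amount to forests of `r_n` trees planted at level `n`, so
their total weight is the weight of the levels of `t` below `n` times `forestWeight`, evaluated at
the number of vertices not on those levels (`gibbsWeight_setOf_truncate_eq`). No bijective cycle
lemma is needed: the closed form satisfies the same root-removal recursion as forests do, and
induction over levels identifies the two.

For `D ≥ 2` the weights can be tilted to a critical offspring law, and a local limit theorem yields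
`forestWeight w N k ~ c_k * N^(-3/2) * q^(-N)`. Ratios of forest weights therefore converge; for `D
= 1` they are explicit. Hence every neighbourhood of the root has a limiting probability.

The space of trees is compact, so the Gibbs distributions have a weak cluster point. Events fixing a
neighbourhood are clopen, so the cluster point gives them their limiting probabilities
(`exists_local_limit`). For fixed `n` only finitely many neighbourhoods exist, so pointwise
convergence is convergence in total variation. A neighbourhood with empty level `n` is a complete
finite tree, which a tree with more vertices cannot have as its neighbourhood; its limiting
probability is `0`, and the limit lives on infinite trees. Uniqueness holds because cylinder events
form a generating π-system. -/

open Polynomial in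
/-- The polynomial `∑ w_d X^d` of branching weights. -/
def weightPoly {D : ℕ} (w : Fin (D + 1) → ℝ) : Polynomial ℝ :=
  ∑ d, C (w d) * X ^ (d : ℕ)

/-- The total weight of the plane forests with `k` trees and `N` vertices, in the closed form given
by the cycle lemma. -/
def forestWeight {D : ℕ} (w : Fin (D + 1) → ℝ) (N k : ℕ) : ℝ :=
  -- The factor `k / N` is meaningless here; only the empty forest has no vertices.
  if N = 0 then (if k = 0 then 1 else 0)
  else (k / N : ℝ) * (Polynomial.X ^ k * weightPoly w ^ N).coeff N

/-! ### Forest weights and the root-removal recursion -/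

section ForestWeight

variable {D : ℕ} (w : Fin (D + 1) → ℝ)

theorem coeff_zero_weightPoly : (weightPoly w).coeff 0 = w 0 := by
  simp only [weightPoly, Polynomial.finsetSum_coeff, Polynomial.coeff_C_mul, Polynomial.coeff_X_pow]
  rw [Finset.sum_eq_single 0]
  · simp
  · intro b _ hb
    have : (b : ℕ) ≠ 0 := fun h => hb (Fin.ext h)
    rw [if_neg this.symm, mul_zero]
  · simp

open Polynomial in
theorem X_mul_derivative_weightPoly :
    X * derivative (weightPoly w) = ∑ d, C (w d) * (C ((d : ℕ) : ℝ) * X ^ (d : ℕ)) := by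
  simp only [weightPoly, derivative_sum, Finset.mul_sum]
  refine Finset.sum_congr rfl fun d _ => ?_
  rw [derivative_C_mul, derivative_X_pow]
  rcases Nat.eq_zero_or_pos (d : ℕ) with h | h
  · simp [h]
  · obtain ⟨e, he⟩ := Nat.exists_eq_succ_of_ne_zero h.ne'
    rw [he]
    simp [pow_succ]
    ring

theorem forestWeight_zero_left (k : ℕ) : forestWeight w 0 k = if k = 0 then 1 else 0 := by
  simp [forestWeight]

theorem forestWeight_succ_zero (N : ℕ) : forestWeight w (N + 1) 0 = 0 := by
  simp [forestWeight]

theorem forestWeight_of_lt {N k : ℕ} (h : N < k) : forestWeight w N k = 0 := by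
  unfold forestWeight
  split_ifs with h1 h2
  · omega
  · rfl
  · rw [mul_comm (Polynomial.X ^ k), Polynomial.coeff_mul_X_pow', if_neg (by omega), mul_zero]

open Polynomial in
/-- The coefficient of `X ^ N` in `X * (X ^ k * φ ^ (N + 1))'`, computed in two ways. -/
theorem coeff_X_pow_mul_pow_relation (φ : Polynomial ℝ) (k : ℕ) {N : ℕ} (hN : 0 < N) :
    (N : ℝ) * (X ^ k * φ ^ (N + 1)).coeff N = k * (X ^ k * φ ^ (N + 1)).coeff N +
      (N + 1) * (X ^ k * (X * derivative φ) * φ ^ N).coeff N := by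
  have h1 : X * derivative (X ^ k * φ ^ (N + 1)) =
      C (k : ℝ) * (X ^ k * φ ^ (N + 1)) +
        C ((N : ℝ) + 1) * (X ^ k * (X * derivative φ) * φ ^ N) := by
    rw [derivative_mul, derivative_X_pow, derivative_pow]
    rcases Nat.eq_zero_or_pos k with rfl | hk
    · simp; ring
    · obtain ⟨e, rfl⟩ := Nat.exists_eq_succ_of_ne_zero hk.ne'
      simp [pow_succ]; ring
  have h2 := congrArg (fun q => q.coeff N) h1
  simp only [coeff_add, coeff_C_mul] at h2
  rw [← h2]
  generalize X ^ k * φ ^ (N + 1) = G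
  obtain ⟨M, rfl⟩ := Nat.exists_eq_succ_of_ne_zero hN.ne'
  rw [Nat.succ_eq_add_one, coeff_X_mul, coeff_derivative]
  push_cast; ring

open Polynomial in
/-- Removing the root of the first tree of a forest. -/
theorem forestWeight_succ_succ (N k : ℕ) :
    forestWeight w (N + 1) (k + 1) = ∑ d, w d * forestWeight w N (k + d) := by
  -- For `N = 0` the right-hand side involves the default value instead of the coefficient formula.
  rcases Nat.eq_zero_or_pos N with rfl | hN
  · have h1 : ∀ d : Fin (D + 1), w d * forestWeight w 0 (k + d) =
        if k = 0 ∧ d = 0 then w 0 else 0 := by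
      intro d
      rw [forestWeight_zero_left]
      by_cases hk : k = 0 <;> by_cases hd : d = 0 <;> simp [hk, hd]
    rw [Finset.sum_congr rfl fun d _ => h1 d]
    rcases Nat.eq_zero_or_pos k with rfl | hk
    · have := coeff_X_mul (weightPoly w) 0
      rw [zero_add] at this
      simp [forestWeight, this, coeff_zero_weightPoly]
    · rw [forestWeight_of_lt w (by omega)]
      simp [hk.ne']
  · have hN' : (N : ℝ) ≠ 0 := by exact_mod_cast hN.ne'
    have hL : forestWeight w (N + 1) (k + 1) =
        ((k : ℝ) + 1) / (N + 1) * (X ^ k * weightPoly w ^ (N + 1)).coeff N := by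
      have : (X ^ (k + 1) * weightPoly w ^ (N + 1)).coeff (N + 1) =
          (X ^ k * weightPoly w ^ (N + 1)).coeff N := by
        rw [pow_succ' X k, mul_assoc, coeff_X_mul]
      simp only [forestWeight, Nat.succ_ne_zero, if_false, this]
      push_cast; ring
    -- The factor `k + d` splits the sum: the `k` part reassembles the polynomial `φ`, the `d` part
    -- reassembles `X * φ'`.
    have hsum : ∑ d, w d * forestWeight w N (k + d) =
        (k * (X ^ k * weightPoly w ^ (N + 1)).coeff N +
          (X ^ k * (X * derivative (weightPoly w)) * weightPoly w ^ N).coeff N) / N := by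
      have e1 : ∀ d : Fin (D + 1), w d * forestWeight w N (k + d) =
          (C (k : ℝ) * (X ^ k * ((C (w d) * X ^ (d : ℕ)) * weightPoly w ^ N)) +
            X ^ k * (C (w d) * (C ((d : ℕ) : ℝ) * X ^ (d : ℕ))) * weightPoly w ^ N).coeff N
              / N := by
        intro d
        have : (C (k : ℝ) * (X ^ k * ((C (w d) * X ^ (d : ℕ)) * weightPoly w ^ N)) +
            X ^ k * (C (w d) * (C ((d : ℕ) : ℝ) * X ^ (d : ℕ))) * weightPoly w ^ N) =
            C (w d * (k + (d : ℕ))) * (X ^ (k + (d : ℕ)) * weightPoly w ^ N) := by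
          simp only [C_mul, C_add, pow_add]; ring
        rw [this, coeff_C_mul]
        simp only [forestWeight, hN.ne', if_false]
        push_cast; ring
      rw [Finset.sum_congr rfl fun d _ => e1 d, ← Finset.sum_div, ← finsetSum_coeff,
        Finset.sum_add_distrib, ← Finset.mul_sum, ← Finset.sum_mul, ← Finset.mul_sum,
        ← Finset.sum_mul, ← Finset.mul_sum, ← X_mul_derivative_weightPoly, coeff_add, coeff_C_mul,
        pow_succ' (weightPoly w) N, ← weightPoly]
    have hrel := coeff_X_pow_mul_pow_relation (weightPoly w) k hN
    rw [hL, hsum]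
    have : (N : ℝ) + 1 ≠ 0 := by positivity
    field_simp
    linear_combination hrel

/-- Removing the roots of the first `j` trees of a forest. -/
theorem forestWeight_add_add (N m j : ℕ) :
    forestWeight w (N + j) (m + j) =
      ∑ d : Fin j → Fin (D + 1), (∏ i, w (d i)) * forestWeight w N (m + ∑ i, (d i : ℕ)) := by
  induction j generalizing m with
  | zero => simp
  | succ j ih =>
    rw [← add_assoc, ← add_assoc, forestWeight_succ_succ,
      ← (Fin.consEquiv fun _ => Fin (D + 1)).sum_comp, Fintype.sum_prod_type]
    refine Finset.sum_congr rfl fun e _ => ?_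
    rw [show m + j + (e : ℕ) = (m + e) + j by ring, ih, Finset.mul_sum]
    refine Finset.sum_congr rfl fun d _ => ?_
    simp [Fin.consEquiv, Fin.prod_univ_succ, Fin.sum_univ_succ, mul_assoc, add_assoc]

/-- Removing all roots of a forest. -/
theorem forestWeight_add_self (N k : ℕ) :
    forestWeight w (N + k) k =
      ∑ d : Fin k → Fin (D + 1), (∏ i, w (d i)) * forestWeight w N (∑ i, (d i : ℕ)) := by
  simpa using forestWeight_add_add w N 0 k

theorem forestWeight_nonneg (hw : ∀ d, 0 ≤ w d) (N k : ℕ) : 0 ≤ forestWeight w N k := by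
  induction N generalizing k with
  | zero => rw [forestWeight_zero_left]; split_ifs <;> norm_num
  | succ N ih =>
    cases k with
    | zero => rw [forestWeight_succ_zero]
    | succ k =>
      rw [forestWeight_succ_succ]
      exact Finset.sum_nonneg fun d _ => mul_nonneg (hw d) (ih _)

theorem forestWeight_one_one : forestWeight w 1 1 = w 0 := by
  have := Polynomial.coeff_X_mul (weightPoly w) 0
  rw [zero_add] at this
  simp [forestWeight, this, coeff_zero_weightPoly]

/-- The path with `N + 1` vertices already contributes: the term `d = 1` of the recursion exists
since `D ≥ 1`. -/
theorem forestWeight_one_pos (hD : 1 ≤ D) (hw : ∀ d, 0 < w d) (N : ℕ) :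
    0 < forestWeight w (N + 1) 1 := by
  induction N with
  | zero => rw [zero_add, forestWeight_one_one]; exact hw 0
  | succ N ih =>
    rw [show (1 : ℕ) = 0 + 1 from rfl, forestWeight_succ_succ]
    refine (mul_pos (hw ⟨1, by omega⟩) ih).trans_le ?_
    refine le_trans (le_of_eq ?_) (Finset.single_le_sum
      (f := fun d : Fin (D + 1) => w d * forestWeight w (N + (0 + 1)) (0 + d))
      (fun d _ => mul_nonneg (hw d).le (forestWeight_nonneg w (fun d => (hw d).le) _ _))
      (Finset.mem_univ ⟨1, by omega⟩))
    simp

end ForestWeight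

/-! ### Fourier inversion and the local limit theorem -/

theorem integral_exp_int_mul_I (n : ℤ) :
    ∫ θ in (-Real.pi)..Real.pi, Complex.exp (n * θ * Complex.I) =
      if n = 0 then 2 * (Real.pi : ℂ) else 0 := by
  split_ifs with h
  · simp [h]; ring
  · have hn : (n : ℂ) * Complex.I ≠ 0 := by simp [h]
    have h1 : ∀ θ : ℝ, Complex.exp (n * θ * Complex.I) = Complex.exp ((n * Complex.I) * θ) := by
      intro θ; congr 1; ring
    simp_rw [h1]
    rw [integral_exp_mul_complex hn]
    have : Complex.exp ((n * Complex.I) * (Real.pi : ℝ)) =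
        Complex.exp ((n * Complex.I) * ((-Real.pi : ℝ) : ℂ)) := by
      rw [Complex.exp_eq_exp_iff_exists_int]
      exact ⟨n, by push_cast; ring⟩
    rw [this, sub_self, zero_div]

/-- The coefficients of a polynomial are its Fourier coefficients on the unit circle. -/
theorem integral_eval_exp_mul_exp (Q : Polynomial ℂ) (N : ℕ) :
    ∫ θ in (-Real.pi)..Real.pi,
      Q.eval (Complex.exp (θ * Complex.I)) * Complex.exp (-(N * θ * Complex.I)) =
      2 * Real.pi * Q.coeff N := by
  have h1 : ∀ θ : ℝ, Q.eval (Complex.exp (θ * Complex.I)) * Complex.exp (-(N * θ * Complex.I)) =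
      ∑ i ∈ Finset.range (Q.natDegree + N + 1),
        Q.coeff i * Complex.exp (((i - N : ℤ) : ℂ) * θ * Complex.I) := by
    intro θ
    rw [Polynomial.eval_eq_sum_range' (show Q.natDegree < Q.natDegree + N + 1 by omega),
      Finset.sum_mul]
    refine Finset.sum_congr rfl fun i _ => ?_
    rw [← Complex.exp_nat_mul, mul_assoc, ← Complex.exp_add]
    congr 2; push_cast; ring
  simp_rw [h1]
  rw [intervalIntegral.integral_finsetSum]
  · simp_rw [intervalIntegral.integral_const_mul, integral_exp_int_mul_I]
    rw [Finset.sum_eq_single N]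
    · simp [mul_comm]
    · intro b _ hb
      rw [if_neg (by omega), mul_zero]
    · intro h; simp at h
  · intro i _
    exact Continuous.intervalIntegrable (by fun_prop) _ _

/-- The characteristic function of the centred offspring law `p`. -/
def offspringCharFun {D : ℕ} (p : Fin (D + 1) → ℝ) (θ : ℝ) : ℂ :=
  ∑ d, (p d : ℂ) * Complex.exp (((d : ℕ) - 1 : ℝ) * θ * Complex.I)

section LocalLimit

variable {D : ℕ} (p : Fin (D + 1) → ℝ)

theorem continuous_offspringCharFun : Continuous (offspringCharFun p) := by
  unfold offspringCharFun; fun_prop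

/-- The centring by `-1` in `offspringCharFun` absorbs the factor `exp (-(N * θ * I))` of Fourier
inversion. -/
theorem integral_offspringCharFun_pow (k N : ℕ) :
    ∫ θ in (-Real.pi)..Real.pi, Complex.exp (k * θ * Complex.I) * offspringCharFun p θ ^ N =
      2 * Real.pi * ((Polynomial.X ^ k * weightPoly p ^ N).coeff N : ℝ) := by
  have := integral_eval_exp_mul_exp
    ((Polynomial.X ^ k * weightPoly p ^ N).map (algebraMap ℝ ℂ)) N
  rw [Polynomial.coeff_map] at this
  refine Eq.trans ?_ this
  refine intervalIntegral.integral_congr fun θ _ => ?_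
  have h1 : Polynomial.eval (Complex.exp (θ * Complex.I))
      ((weightPoly p).map (algebraMap ℝ ℂ)) =
      offspringCharFun p θ * Complex.exp (θ * Complex.I) := by
    simp only [weightPoly, Polynomial.map_sum, Polynomial.map_mul, Polynomial.map_C,
      Polynomial.map_pow, Polynomial.map_X, Polynomial.eval_finsetSum, Polynomial.eval_mul,
      Polynomial.eval_C, Polynomial.eval_pow, Polynomial.eval_X, offspringCharFun, Finset.sum_mul,
      ← Complex.exp_nat_mul, mul_assoc, ← Complex.exp_add]
    refine Finset.sum_congr rfl fun d _ => ?_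
    simp only [Complex.coe_algebraMap]
    congr 2; push_cast; ring
  simp only [Polynomial.map_mul, Polynomial.map_pow, Polynomial.map_X, Polynomial.eval_mul,
    Polynomial.eval_pow, Polynomial.eval_X, h1, mul_pow]
  rw [← Complex.exp_nat_mul, ← Complex.exp_nat_mul, mul_assoc (Complex.exp _),
    mul_assoc (offspringCharFun p θ ^ N), ← Complex.exp_add]
  rw [show (N : ℂ) * (θ * Complex.I) + -(N * θ * Complex.I) = 0 by ring, Complex.exp_zero, mul_one]
  congr 2; ring

/-- The adjacent degrees `0` and `1` both have positive mass, which rules out periodicity. Their two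
terms alone lose `p 0 * p 1 * (1 - cos θ)` in modulus, and this is at least quadratic in `θ` on
`[-π, π]`. The bound provides a Gaussian majorant after rescaling. -/
theorem norm_offspringCharFun_le (hD : 1 ≤ D) (hp : ∀ d, 0 < p d) (h1 : ∑ d, p d = 1) :
    ∃ c : ℝ, 0 < c ∧ ∀ θ : ℝ, |θ| ≤ Real.pi → ‖offspringCharFun p θ‖ ≤ Real.exp (-c * θ ^ 2) := by
  obtain ⟨D, rfl⟩ := Nat.exists_eq_add_of_le' hD
  set a := p 0 with ha
  set b := p 1 with hb
  have hsplit : ∑ d, p d = a + (b + ∑ d : Fin D, p d.succ.succ) := by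
    rw [Fin.sum_univ_succ, Fin.sum_univ_succ]; rfl
  have hr : 0 ≤ ∑ d : Fin D, p d.succ.succ := Finset.sum_nonneg fun d _ => (hp _).le
  have ha0 : 0 < a := hp _
  have hb0 : 0 < b := hp _
  refine ⟨a * b * (2 / Real.pi ^ 2), by positivity, fun θ hθ => ?_⟩
  have hcos := Real.cos_le_one_sub_mul_cos_sq hθ
  have hnorm : ∀ x : ℝ, ‖Complex.exp (x * θ * Complex.I)‖ = 1 := by
    intro x; rw [← Complex.ofReal_mul, Complex.norm_exp_ofReal_mul_I]
  have hab : ‖(a : ℂ) * Complex.exp (((0 : ℝ) - 1 : ℝ) * θ * Complex.I) + b‖ ≤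
      a + b - a * b * (1 - Real.cos θ) := by
    have hc1 := Real.cos_le_one θ
    have hc2 := Real.neg_one_le_cos θ
    refine le_of_sq_le_sq ?_ (by nlinarith [mul_pos ha0 hb0])
    have : (((0 : ℝ) - 1 : ℝ) * θ * Complex.I : ℂ) = ((-θ : ℝ) : ℂ) * Complex.I := by
      push_cast; ring
    rw [this, Complex.sq_norm, Complex.normSq_apply]
    simp only [Complex.add_re, Complex.add_im, Complex.re_ofReal_mul, Complex.im_ofReal_mul,
      Complex.exp_ofReal_mul_I_re, Complex.exp_ofReal_mul_I_im, Complex.ofReal_re,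
      Complex.ofReal_im, Real.cos_neg, Real.sin_neg]
    have hs := Real.sin_sq_add_cos_sq θ
    have : (a * Real.cos θ + b) * (a * Real.cos θ + b) + (a * -Real.sin θ + 0) * (a * -Real.sin θ + 0)
        = (a + b) ^ 2 - 2 * (a * b * (1 - Real.cos θ)) := by
      linear_combination a ^ 2 * hs
    rw [this]
    have hx : 0 ≤ a * b * (1 - Real.cos θ) := by
      have := mul_pos ha0 hb0
      exact mul_nonneg this.le (by linarith)
    -- With `x = a * b * (1 - cos θ)`, this gives `(a + b)^2 - 2 * x ≤ (a + b - x)^2`.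
    have hab1 : a + b ≤ 1 := by linarith
    nlinarith [sq_nonneg (a * b * (1 - Real.cos θ))]
  calc ‖offspringCharFun p θ‖
      = ‖((a : ℂ) * Complex.exp (((0 : ℝ) - 1 : ℝ) * θ * Complex.I) + b) +
        ∑ d : Fin D, (p d.succ.succ : ℂ) *
          Complex.exp ((((d.succ.succ : Fin (D + 2)) : ℕ) - 1 : ℝ) * θ * Complex.I)‖ := by
        unfold offspringCharFun
        rw [Fin.sum_univ_succ, Fin.sum_univ_succ, ← add_assoc]
        simp [ha, hb]
    _ ≤ (a + b - a * b * (1 - Real.cos θ)) + ∑ d : Fin D, p d.succ.succ := by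
        refine (norm_add_le _ _).trans (add_le_add hab ?_)
        refine (norm_sum_le _ _).trans (Finset.sum_le_sum fun d _ => ?_)
        rw [norm_mul, hnorm, mul_one, Complex.norm_of_nonneg (hp _).le]
    _ = 1 - a * b * (1 - Real.cos θ) := by linarith
    _ ≤ 1 - a * b * (2 / Real.pi ^ 2) * θ ^ 2 := by
        have := mul_le_mul_of_nonneg_left hcos (mul_pos ha0 hb0).le
        linarith
    _ ≤ _ := by
        have := Real.add_one_le_exp (-(a * b * (2 / Real.pi ^ 2)) * θ ^ 2)
        linarith

/-- Second-order Taylor expansion; the cubic remainder times `N` is of order `1 / √N`. -/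
theorem tendsto_nat_mul_exp_div_sqrt (x : ℝ) :
    Tendsto (fun N : ℕ => (N : ℂ) * (Complex.exp ((x / √N : ℝ) * Complex.I) - 1 -
      (x / √N : ℝ) * Complex.I)) atTop (𝓝 (-(x ^ 2 / 2 : ℝ))) := by
  rw [tendsto_iff_norm_sub_tendsto_zero]
  have hlim : Tendsto (fun N : ℕ => |x| / √N) atTop (𝓝 0) :=
    tendsto_const_nhds.div_atTop (Real.tendsto_sqrt_atTop.comp tendsto_natCast_atTop_atTop)
  have hlim' : Tendsto (fun N : ℕ => |x| ^ 2 * (|x| / √N)) atTop (𝓝 0) := by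
    have := hlim.const_mul (|x| ^ 2)
    rwa [mul_zero] at this
  refine squeeze_zero' (Eventually.of_forall fun _ => norm_nonneg _) ?_ hlim'
  filter_upwards [hlim.eventually (ge_mem_nhds zero_lt_one), eventually_gt_atTop 0] with N hN hN0
  have hN1 : (0 : ℝ) < N := by exact_mod_cast hN0
  have hs : 0 < √(N : ℝ) := Real.sqrt_pos.2 hN1
  have hss : √(N : ℝ) ^ 2 = N := Real.sq_sqrt hN1.le
  have hz : ‖((x / √N : ℝ) : ℂ) * Complex.I‖ = |x| / √N := by
    rw [norm_mul, Complex.norm_I, mul_one, Complex.norm_real, Real.norm_eq_abs, abs_div,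
      abs_of_pos hs]
  have hb := Complex.exp_bound (x := ((x / √N : ℝ) : ℂ) * Complex.I) (by rw [hz]; exact hN)
    (show 0 < 3 by norm_num)
  rw [hz] at hb
  have key : (N : ℂ) * (Complex.exp ((x / √N : ℝ) * Complex.I) - 1 -
      (x / √N : ℝ) * Complex.I) - (-(x ^ 2 / 2 : ℝ) : ℂ) = (N : ℂ) *
      (Complex.exp (((x / √N : ℝ) : ℂ) * Complex.I) -
        ∑ m ∈ Finset.range 3, (((x / √N : ℝ) : ℂ) * Complex.I) ^ m / (m.factorial : ℂ)) := by
    simp only [Finset.sum_range_succ, Finset.sum_range_zero, mul_pow, Complex.I_sq]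
    have h2 : (N : ℂ) * ((x / √N : ℝ) : ℂ) ^ 2 = ((x ^ 2 : ℝ) : ℂ) := by
      rw [← Complex.ofReal_natCast, ← Complex.ofReal_pow, ← Complex.ofReal_mul, div_pow, hss]
      congr 1; field_simp
    simp [Nat.factorial]
    push_cast at h2
    linear_combination (-1 / 2 : ℂ) * h2
  rw [key, norm_mul, Complex.norm_natCast]
  calc (N : ℝ) * _ ≤ N * ((|x| / √N) ^ 3 * (Nat.succ 3 * ((Nat.factorial 3 : ℝ) * (3 : ℕ))⁻¹)) :=
        mul_le_mul_of_nonneg_left hb hN1.le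
    _ ≤ N * ((|x| / √N) ^ 3 * 1) := by
        gcongr
        norm_num [Nat.factorial]
    _ = |x| ^ 2 * (|x| / √N) := by
        rw [mul_one]
        generalize √(N : ℝ) = s at hs hss
        rw [← hss]
        field_simp

/-- The central limit theorem for characteristic functions. Criticality cancels the first-order
terms, leaving half the variance in `(1 + z_N / N)^N`. -/
theorem tendsto_offspringCharFun_pow (h1 : ∑ d, p d = 1) (hm : ∑ d, p d * ((d : ℕ) - 1 : ℝ) = 0)
    (u : ℝ) :
    Tendsto (fun N : ℕ => offspringCharFun p (u / √N) ^ N) atTop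
      (𝓝 (Complex.exp (-((∑ d, p d * ((d : ℕ) - 1 : ℝ) ^ 2) / 2 * u ^ 2 : ℝ)))) := by
  have h := Complex.tendsto_one_add_pow_exp_of_tendsto
    (g := fun N : ℕ => offspringCharFun p (u / √N) - 1)
    (t := (-((∑ d, p d * ((d : ℕ) - 1 : ℝ) ^ 2) / 2 * u ^ 2 : ℝ))) ?_
  · simpa using h
  · have hsum : Tendsto (fun N : ℕ => ∑ d, (p d : ℂ) * ((N : ℂ) *
        (Complex.exp ((((d : ℕ) - 1 : ℝ) * u / √N : ℝ) * Complex.I) - 1 -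
        (((d : ℕ) - 1 : ℝ) * u / √N : ℝ) * Complex.I))) atTop
        (𝓝 (∑ d, (p d : ℂ) * (-(((((d : ℕ) - 1 : ℝ) * u) ^ 2 / 2 : ℝ))))) :=
      tendsto_finsetSum _ fun d _ => (tendsto_nat_mul_exp_div_sqrt _).const_mul _
    have h1' : ∑ d, (p d : ℂ) = 1 := by exact_mod_cast h1
    have hm' : ∑ d, (p d : ℂ) * ((d : ℕ) - 1 : ℝ) = 0 := by exact_mod_cast hm
    convert hsum using 2 with N
    · have e1 : ∀ d : Fin (D + 1), (p d : ℂ) * ((N : ℂ) *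
          (Complex.exp ((((d : ℕ) - 1 : ℝ) * u / √N : ℝ) * Complex.I) - 1 -
          (((d : ℕ) - 1 : ℝ) * u / √N : ℝ) * Complex.I)) =
          (N : ℂ) * ((p d : ℂ) * Complex.exp (((d : ℕ) - 1 : ℝ) * (u / √N : ℝ) * Complex.I))
          - (N : ℂ) * (p d : ℂ) - ((N : ℂ) * ((u / √N : ℝ) * Complex.I)) *
            ((p d : ℂ) * ((d : ℕ) - 1 : ℝ)) := by
        intro d
        push_cast
        rw [show ((d : ℂ) - 1) * (u / (√(N : ℝ) : ℂ)) = ((d : ℂ) - 1) * u / (√(N : ℝ) : ℂ) by ring]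
        ring
      rw [Finset.sum_congr rfl fun d _ => e1 d, Finset.sum_sub_distrib, Finset.sum_sub_distrib,
        ← Finset.mul_sum, ← Finset.mul_sum, ← Finset.mul_sum, h1', hm', offspringCharFun]
      ring
    · push_cast
      rw [Finset.sum_div, Finset.sum_mul, ← Finset.sum_neg_distrib]
      refine Finset.sum_congr rfl fun d _ => ?_
      ring

/-- A local limit theorem: the law of the sum of `N` independent variables of the critical
offspring law `p`, near its mean `N`. -/
theorem tendsto_sqrt_mul_coeff (hD : 1 ≤ D) (hp : ∀ d, 0 < p d) (h1 : ∑ d, p d = 1)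
    (hm : ∑ d, p d * ((d : ℕ) - 1 : ℝ) = 0) :
    ∃ L : ℝ, 0 < L ∧ ∀ k : ℕ, Tendsto
      (fun N : ℕ => √N * (Polynomial.X ^ k * weightPoly p ^ N).coeff N) atTop (𝓝 L) := by
  obtain ⟨c, hc, hbound⟩ := norm_offspringCharFun_le p hD hp h1
  set v := (∑ d, p d * ((d : ℕ) - 1 : ℝ) ^ 2) / 2 with hv
  have hv0 : 0 < v := by
    refine div_pos (Finset.sum_pos' (fun d _ => mul_nonneg (hp d).le (sq_nonneg _))
      ⟨0, Finset.mem_univ _, ?_⟩) two_pos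
    simpa using hp 0
  -- The constant is the Gaussian integral over `2π`; it does not depend on `k` because `exp (k * u
  -- / √N * I)` tends to `1`.
  refine ⟨(2 * Real.pi)⁻¹ * √(Real.pi / v), by positivity, fun k => ?_⟩
  -- The Fourier integrand under `θ = u / √N`, extended by zero to the line so that dominated
  -- convergence applies.
  let F : ℕ → ℝ → ℂ := fun N => (Set.Ioc (-(Real.pi * √N)) (Real.pi * √N)).indicator fun u =>
    Complex.exp (k * (u / √N : ℝ) * Complex.I) * offspringCharFun p (u / √N) ^ N
  have hF : Tendsto (fun N => ∫ u, F N u) atTop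
      (𝓝 (∫ u : ℝ, Complex.exp (-(v * u ^ 2 : ℝ)))) := by
    refine tendsto_integral_filter_of_dominated_convergence (fun u => Real.exp (-c * u ^ 2))
      (Eventually.of_forall fun N => ?_) ?_ (integrable_exp_neg_mul_sq hc)
      (Eventually.of_forall fun u => ?_)
    · refine (Continuous.aestronglyMeasurable ?_).indicator measurableSet_Ioc
      have := continuous_offspringCharFun p
      fun_prop
    · filter_upwards [eventually_gt_atTop 0] with N hN0
      have hN1 : (0 : ℝ) < N := by exact_mod_cast hN0
      have hs : 0 < √(N : ℝ) := Real.sqrt_pos.2 hN1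
      refine Eventually.of_forall fun u => ?_
      by_cases hu : u ∈ Set.Ioc (-(Real.pi * √N)) (Real.pi * √N)
      · simp only [F, Set.indicator_of_mem hu]
        rw [norm_mul, norm_pow, show ((k : ℂ) * (u / √N : ℝ) * Complex.I) =
          ((k * (u / √N) : ℝ) : ℂ) * Complex.I by push_cast; ring, Complex.norm_exp_ofReal_mul_I,
          one_mul]
        have habs : |u / √N| ≤ Real.pi := by
          rw [abs_div, abs_of_pos hs, div_le_iff₀ hs, abs_le]
          exact ⟨hu.1.le, hu.2⟩
        calc _ ≤ Real.exp (-c * (u / √N) ^ 2) ^ N :=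
              pow_le_pow_left₀ (norm_nonneg _) (hbound _ habs) _
          _ = Real.exp (-c * u ^ 2) := by
            rw [← Real.exp_nat_mul, div_pow, Real.sq_sqrt hN1.le]
            congr 1; field_simp
      · simp only [F, Set.indicator_of_notMem hu, norm_zero]
        positivity
    · have hlim : Tendsto (fun N : ℕ => u / √N) atTop (𝓝 0) :=
        tendsto_const_nhds.div_atTop (Real.tendsto_sqrt_atTop.comp tendsto_natCast_atTop_atTop)
      have hexp : Tendsto (fun N : ℕ => Complex.exp (k * (u / √N : ℝ) * Complex.I)) atTop
          (𝓝 1) := by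
        have hcont : Continuous fun t : ℝ => Complex.exp (k * (t : ℂ) * Complex.I) := by fun_prop
        simpa [Function.comp_def] using (hcont.tendsto 0).comp hlim
      have := hexp.mul (tendsto_offspringCharFun_pow p h1 hm u)
      rw [one_mul] at this
      refine this.congr' ?_
      have hlarge : Tendsto (fun N : ℕ => Real.pi * √N) atTop atTop :=
        (Real.tendsto_sqrt_atTop.comp tendsto_natCast_atTop_atTop).const_mul_atTop Real.pi_pos
      filter_upwards [hlarge.eventually_gt_atTop |u|] with N hN
      have hu : u ∈ Set.Ioc (-(Real.pi * √N)) (Real.pi * √N) :=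
        ⟨(abs_lt.1 hN).1, (abs_lt.1 hN).2.le⟩
      simp only [F, Set.indicator_of_mem hu]
  have hint : ∀ᶠ N : ℕ in atTop, ∫ u, F N u =
      ((2 * Real.pi * (√N * (Polynomial.X ^ k * weightPoly p ^ N).coeff N) : ℝ) : ℂ) := by
    filter_upwards [eventually_gt_atTop 0] with N hN0
    have hN1 : (0 : ℝ) < N := by exact_mod_cast hN0
    have hs : 0 < √(N : ℝ) := Real.sqrt_pos.2 hN1
    simp only [F]
    rw [integral_indicator measurableSet_Ioc, ← intervalIntegral.integral_of_le
      (by have := Real.pi_pos; nlinarith [mul_pos this hs])]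
    have := intervalIntegral.integral_comp_div (a := -(Real.pi * √N)) (b := Real.pi * √N)
      (fun θ : ℝ => Complex.exp (k * (θ : ℂ) * Complex.I) * offspringCharFun p θ ^ N) hs.ne'
    rw [this, neg_div, mul_div_cancel_right₀ _ hs.ne', integral_offspringCharFun_pow]
    rw [Complex.real_smul]
    push_cast; ring
  have hG : ∫ u : ℝ, Complex.exp (-(v * u ^ 2 : ℝ)) = ((√(Real.pi / v) : ℝ) : ℂ) := by
    rw [← integral_gaussian v, ← integral_complex_ofReal]
    congr 1; ext u; push_cast; congr 1; ring
  have h2 := (hF.congr' hint)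
  rw [hG] at h2
  have h3 := (Complex.continuous_re.tendsto _).comp h2
  simp only [Complex.ofReal_re, Function.comp_def] at h3
  have h4 := h3.const_mul (2 * Real.pi)⁻¹
  refine h4.congr fun N => ?_
  have := Real.pi_pos
  field_simp

end LocalLimit

/-! ### Critical tilting and ratios of forest weights -/

section Ratio

variable {D : ℕ} (w : Fin (D + 1) → ℝ)

/-- The tilt that makes the offspring law critical. -/
theorem exists_critical_tilt (hD : 2 ≤ D) (hw : ∀ d, 0 < w d) :
    ∃ s : ℝ, 0 < s ∧ ∑ d, w d * s ^ (d : ℕ) * ((d : ℕ) - 1 : ℝ) = 0 := by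
  obtain ⟨D, rfl⟩ := Nat.exists_eq_add_of_le' hD
  set F : ℝ → ℝ := fun s => ∑ d, w d * s ^ (d : ℕ) * ((d : ℕ) - 1 : ℝ) with hF
  -- Only `d = 0` contributes negatively and `d = 1` vanishes; `D ≥ 2` supplies the positive
  -- quadratic term.
  have hsplit : ∀ s, F s = -w 0 + (w 2 * s ^ 2 +
      ∑ d : Fin D, w d.succ.succ.succ * s ^ (d + 3 : ℕ) * (d + 2 : ℝ)) := by
    intro s
    simp only [hF]
    rw [Fin.sum_univ_succ, Fin.sum_univ_succ, Fin.sum_univ_succ]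
    simp only [Fin.val_zero, Fin.val_succ, Fin.succ_zero_eq_one, Fin.succ_one_eq_two]
    have : ∀ d : Fin D, w d.succ.succ.succ * s ^ ((d : ℕ) + 1 + 1 + 1) *
        (((d : ℕ) + 1 + 1 + 1 : ℕ) - 1 : ℝ) =
        w d.succ.succ.succ * s ^ (d + 3 : ℕ) * (d + 2 : ℝ) := fun d => by push_cast; ring
    rw [Finset.sum_congr rfl fun d _ => this d]
    norm_num
    rw [Nat.mod_eq_of_lt (by omega)]
    norm_num
  have hcont : Continuous F := by fun_prop
  have h0 : F 0 ≤ 0 := by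
    rw [hsplit]
    simp [(hw 0).le]
  have ha := hw 0
  have hb := hw 2
  -- At this point the quadratic term exactly cancels `-w 0`.
  have h1 : 0 ≤ F (√(w 0 / w 2)) := by
    rw [hsplit, Real.sq_sqrt (div_pos ha hb).le, mul_div_cancel₀ _ hb.ne']
    have : 0 ≤ ∑ d : Fin D, w d.succ.succ.succ * √(w 0 / w 2) ^ (d + 3 : ℕ) * (d + 2 : ℝ) :=
      Finset.sum_nonneg fun d _ => by have := hw d.succ.succ.succ; positivity
    linarith
  obtain ⟨s, hs, hs0⟩ := intermediate_value_Icc (Real.sqrt_nonneg (w 0 / w 2))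
    hcont.continuousOn ⟨h0, h1⟩
  refine ⟨s, lt_of_le_of_ne hs.1 ?_, hs0⟩
  rintro rfl
  rw [hsplit] at hs0
  simp at hs0
  exact ha.ne' hs0

open Polynomial in
-- Substituting `s * X` for `X` shows that tilting changes the coefficient only by an explicit
-- geometric factor.
theorem coeff_X_pow_mul_weightPoly_pow_tilt {s Z : ℝ} (hZ : Z ≠ 0) (N k : ℕ) :
    s ^ N * (X ^ k * weightPoly w ^ N).coeff N =
      Z ^ N * s ^ k * (X ^ k * weightPoly (fun d => w d * s ^ (d : ℕ) / Z) ^ N).coeff N := by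
  have h1 : (weightPoly w).comp (C s * X) = C Z * weightPoly (fun d => w d * s ^ (d : ℕ) / Z) := by
    simp only [weightPoly, Polynomial.sum_comp, mul_comp, C_comp, pow_comp, X_comp, Finset.mul_sum]
    refine Finset.sum_congr rfl fun d _ => ?_
    rw [mul_pow, ← C_pow, ← mul_assoc, ← mul_assoc, ← C_mul, ← C_mul, mul_div_cancel₀ _ hZ]
  have h2 : (X ^ k * weightPoly w ^ N).comp (C s * X) =
      C (Z ^ N * s ^ k) * (X ^ k * weightPoly (fun d => w d * s ^ (d : ℕ) / Z) ^ N) := by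
    rw [mul_comp, pow_comp, pow_comp, X_comp, h1]
    simp only [C_mul, C_pow, mul_pow]; ring
  have h3 := congrArg (fun q => q.coeff N) h2
  simp only [comp_C_mul_X_coeff, coeff_C_mul] at h3
  rw [← h3, mul_comm]

/-- The exponent `3/2` combines the factor `k / N` of the cycle lemma with the `1 / √N` of the local
limit theorem. Positivity is recorded only for `k = 1`, the case that serves as denominator. -/
theorem exists_tendsto_forestWeight_mul (hD : 2 ≤ D) (hw : ∀ d, 0 < w d) :
    ∃ q L : ℝ, 0 < q ∧ 0 < L ∧ ∃ c : ℕ → ℝ, c 1 = L ∧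
      ∀ k, Tendsto (fun N : ℕ => forestWeight w N k * √N ^ 3 * q ^ N) atTop (𝓝 (c k)) := by
  obtain ⟨s, hs, hs0⟩ := exists_critical_tilt w hD hw
  set Z := ∑ d, w d * s ^ (d : ℕ) with hZ
  have hZ0 : 0 < Z := Finset.sum_pos (fun d _ => mul_pos (hw d) (pow_pos hs _)) ⟨0, by simp⟩
  obtain ⟨L, hL, hlim⟩ := tendsto_sqrt_mul_coeff (fun d => w d * s ^ (d : ℕ) / Z) (by omega)
    (fun d => div_pos (mul_pos (hw d) (pow_pos hs _)) hZ0)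
    (by rw [← Finset.sum_div, div_self hZ0.ne'])
    (by
      have : ∀ d : Fin (D + 1), w d * s ^ (d : ℕ) / Z * ((d : ℕ) - 1 : ℝ) =
        (w d * s ^ (d : ℕ) * ((d : ℕ) - 1 : ℝ)) / Z := fun d => by ring
      rw [Finset.sum_congr rfl fun d _ => this d, ← Finset.sum_div, hs0, zero_div])
  refine ⟨s / Z, s * L, by positivity, by positivity, fun k => k * s ^ k * L, by simp, fun k => ?_⟩
  refine ((hlim k).const_mul ((k : ℝ) * s ^ k)).congr' ?_
  filter_upwards [eventually_gt_atTop 0] with N hN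
  have hN1 : (0 : ℝ) < N := by exact_mod_cast hN
  have hss : √(N : ℝ) ^ 2 = N := Real.sq_sqrt hN1.le
  have ht := coeff_X_pow_mul_weightPoly_pow_tilt w (s := s) hZ0.ne' N k
  have hZN : Z ^ N ≠ 0 := pow_ne_zero _ hZ0.ne'
  unfold forestWeight
  rw [if_neg hN.ne', div_pow]
  calc _ = (k : ℝ) / N * √N ^ 2 * √N / Z ^ N * (Z ^ N * s ^ k *
        (Polynomial.X ^ k * weightPoly (fun d => w d * s ^ (d : ℕ) / Z) ^ N).coeff N) := by
        rw [hss]; field_simp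
    _ = _ := by
        rw [← ht]; ring

theorem tendsto_sqrt_add_div_sqrt (m : ℕ) :
    Tendsto (fun N : ℕ => √((N + m : ℕ) : ℝ) / √(N : ℝ)) atTop (𝓝 1) := by
  have h : Tendsto (fun N : ℕ => √(1 + (m : ℝ) / N)) atTop (𝓝 1) := by
    have := (tendsto_const_div_atTop_nhds_zero_nat (m : ℝ)).const_add 1
    simpa using this.sqrt
  refine h.congr' ?_
  filter_upwards [eventually_gt_atTop 0] with N hN
  have hN1 : (0 : ℝ) < N := by exact_mod_cast hN
  rw [← Real.sqrt_div (by positivity)]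
  congr 1
  push_cast
  field_simp

/-- The ratio limit theorem for forest weights. -/
theorem exists_tendsto_forestWeight_div (hD : 1 ≤ D) (hw : ∀ d, 0 < w d) (k m : ℕ)
    (hk : D = 1 → k ≤ 1) :
    ∃ c, Tendsto (fun N => forestWeight w N k / forestWeight w (N + m) 1) atTop (𝓝 c) := by
  -- For `D = 1` no critical tilt exists, but a tree is a path and its weight is geometric in `N`.
  -- With two or more trees the ratio would diverge, hence `hk`.
  rcases hD.eq_or_lt with rfl | hD2
  · have hrec : ∀ N, forestWeight w (N + 2) 1 = w 1 * forestWeight w (N + 1) 1 := by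
      intro N
      have := forestWeight_succ_succ w (N + 1) 0
      simpa [Fin.sum_univ_two, forestWeight_succ_zero] using this
    have hpow : ∀ N, forestWeight w (N + 1 + m) 1 = w 1 ^ m * forestWeight w (N + 1) 1 := by
      intro N
      induction m with
      | zero => simp
      | succ m ih => rw [show N + 1 + (m + 1) = N + m + 2 by ring, hrec,
          show N + m + 1 = N + 1 + m by ring, ih]; ring
    obtain rfl | rfl : k = 0 ∨ k = 1 := by have := hk rfl; omega
    · refine ⟨0, tendsto_const_nhds.congr' ?_⟩
      filter_upwards [eventually_gt_atTop 0] with N hN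
      obtain ⟨N, rfl⟩ := Nat.exists_eq_succ_of_ne_zero hN.ne'
      rw [Nat.succ_eq_add_one, forestWeight_succ_zero, zero_div]
    · refine ⟨(w 1 ^ m)⁻¹, tendsto_const_nhds.congr' ?_⟩
      filter_upwards [eventually_gt_atTop 0] with N hN
      obtain ⟨N, rfl⟩ := Nat.exists_eq_succ_of_ne_zero hN.ne'
      rw [Nat.succ_eq_add_one, hpow]
      have := forestWeight_one_pos w le_rfl hw N
      have := hw 1
      field_simp
  · obtain ⟨q, L, hq, hL, c, hc, hlim⟩ := exists_tendsto_forestWeight_mul w hD2 hw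
    have h1 := ((hlim 1).comp (tendsto_add_atTop_nat m))
    -- The extra factor corrects for the normalisation of the denominator being taken at `N + m`.
    have h2 := ((hlim k).div h1 (by rw [hc]; exact hL.ne')).mul
      (((tendsto_sqrt_add_div_sqrt m).pow 3).mul_const (q ^ m))
    refine ⟨_, h2.congr' ?_⟩
    filter_upwards [eventually_gt_atTop 0] with N hN
    obtain ⟨M, rfl⟩ := Nat.exists_eq_succ_of_ne_zero hN.ne'
    have hpos := forestWeight_one_pos w hD hw (M + m)
    rw [show M + m + 1 = M.succ + m by omega] at hpos
    have hs1 : 0 < √((M.succ : ℕ) : ℝ) := Real.sqrt_pos.2 (by positivity)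
    have hs2 : 0 < √((M.succ + m : ℕ) : ℝ) := Real.sqrt_pos.2 (by positivity)
    simp only [Function.comp_apply, Pi.div_apply]
    have hq' := hq.ne'
    rw [pow_add]
    field_simp

end Ratio

/-! ### Level vectors and numbers of children -/

section LevelVectors

theorem Finset.eq_of_isLowerSet_of_card_eq {α : Type*} [LinearOrder α] {s t : Finset α}
    (hs : IsLowerSet (s : Set α)) (ht : IsLowerSet (t : Set α)) (h : s.card = t.card) : s = t := by
  rcases hs.total ht with hst | hst
  · exact Finset.eq_of_subset_of_card_le (Finset.coe_subset.1 hst) h.ge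
  · exact (Finset.eq_of_subset_of_card_le (Finset.coe_subset.1 hst) h.le).symm

/-- A level vector is determined by the number of children of each vertex. -/
theorem levelVector_unique {K L : ℕ} {x y : Fin L → Fin (K + 1)}
    (hx0 : ∀ l l', l ≤ l' → x l' ≠ 0 → x l ≠ 0) (hx : ∀ l l', l ≤ l' → x l' ≠ 0 → x l ≤ x l')
    (hy0 : ∀ l l', l ≤ l' → y l' ≠ 0 → y l ≠ 0) (hy : ∀ l l', l ≤ l' → y l' ≠ 0 → y l ≤ y l')
    (hxy : ∀ v : Fin (K + 1), v ≠ 0 → (Finset.univ.filter fun l => x l = v).card =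
      (Finset.univ.filter fun l => y l = v).card) : x = y := by
  have hcard : ∀ (z : Fin L → Fin (K + 1)) (v : Fin (K + 1)),
      (Finset.univ.filter fun l => z l ≠ 0 ∧ z l ≤ v).card =
      ∑ u ∈ Finset.univ.filter (fun u : Fin (K + 1) => u ≠ 0 ∧ u ≤ v),
        (Finset.univ.filter fun l => z l = u).card := by
    intro z v
    rw [Finset.card_eq_sum_card_fiberwise (f := z)
      (t := Finset.univ.filter (fun u : Fin (K + 1) => u ≠ 0 ∧ u ≤ v))
      (fun l hl => by simpa using hl)]
    refine Finset.sum_congr rfl fun u hu => ?_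
    congr 1
    ext l
    simp only [Finset.mem_filter, Finset.mem_univ, true_and] at hu ⊢
    exact ⟨fun h => h.2, fun h => ⟨h ▸ hu, h⟩⟩
  -- The indices with parent at most `v` form an initial segment, so their number determines them.
  have hset : ∀ v : Fin (K + 1), (Finset.univ.filter fun l => x l ≠ 0 ∧ x l ≤ v) =
      Finset.univ.filter fun l => y l ≠ 0 ∧ y l ≤ v := by
    intro v
    refine Finset.eq_of_isLowerSet_of_card_eq ?_ ?_ ?_
    · intro l' l hl h
      simp only [Finset.coe_filter, Finset.mem_univ, true_and, Set.mem_ofPred_eq] at h ⊢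
      exact ⟨hx0 l l' hl h.1, (hx l l' hl h.1).trans h.2⟩
    · intro l' l hl h
      simp only [Finset.coe_filter, Finset.mem_univ, true_and, Set.mem_ofPred_eq] at h ⊢
      exact ⟨hy0 l l' hl h.1, (hy l l' hl h.1).trans h.2⟩
    · rw [hcard, hcard]
      refine Finset.sum_congr rfl fun u hu => hxy u ?_
      simp only [Finset.mem_filter, Finset.mem_univ, true_and] at hu
      exact hu.1
  have hiff : ∀ l v, (x l ≠ 0 ∧ x l ≤ v) ↔ (y l ≠ 0 ∧ y l ≤ v) := by
    intro l v
    simpa using congrArg (fun s => l ∈ s) (hset v)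
  funext l
  by_cases h : x l = 0
  · by_contra hne
    have hy1 : y l ≠ 0 := fun h' => hne (h.trans h'.symm)
    exact ((hiff l (y l)).2 ⟨hy1, le_rfl⟩).1 h
  · have h1 := (hiff l (x l)).1 ⟨h, le_rfl⟩
    exact le_antisymm ((hiff l (y l)).2 ⟨h1.1, le_rfl⟩).2 h1.2

/-- `finSigmaFinEquiv` lays the blocks out consecutively: everything in an earlier block lies below
the partial sum at which a later block starts. This is what makes parents nondecreasing along a
level. -/
theorem fst_finSigmaFinEquiv_symm_mono {k : ℕ} (d : Fin k → ℕ) :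
    Monotone fun l => (finSigmaFinEquiv (n := d).symm l).1 := by
  intro l l' hl
  obtain ⟨⟨v, j⟩, rfl⟩ := (finSigmaFinEquiv (n := d)).surjective l
  obtain ⟨⟨v', j'⟩, rfl⟩ := (finSigmaFinEquiv (n := d)).surjective l'
  simp only [Equiv.symm_apply_apply]
  by_contra! hlt
  refine absurd hl (not_le.2 ?_)
  rw [Fin.lt_def, finSigmaFinEquiv_apply, finSigmaFinEquiv_apply]
  let F : ℕ → ℕ := fun i => if h : i < k then d ⟨i, h⟩ else 0
  have hF : ∀ u : Fin k, ∑ i : Fin (u : ℕ), d (Fin.castLE u.2.le i) =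
      ∑ i ∈ Finset.range u, F i := by
    intro u
    rw [Finset.sum_range]
    refine Finset.sum_congr rfl fun i _ => ?_
    simp only [F]
    rw [dif_pos (i.2.trans u.2)]
    rfl
  have hFv : F v' = d v' := by simp [F]
  have h1 : ∑ i ∈ Finset.range (v' + 1), F i ≤ ∑ i ∈ Finset.range v, F i :=
    Finset.sum_le_sum_of_subset (Finset.range_mono hlt)
  rw [Finset.sum_range_succ, hFv] at h1
  have := j'.2
  simp only at this ⊢
  rw [hF, hF]
  omega

/-- Every sequence of numbers of children is realised by a level vector. -/
theorem exists_levelVector {k K L D : ℕ} (hk : k ≤ K) (hL : K * D ≤ L)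
    (d : Fin k → Fin (D + 1)) :
    ∃ x : Fin L → Fin (K + 1), (∀ l l', l ≤ l' → x l' ≠ 0 → x l ≠ 0) ∧
      (∀ l l', l ≤ l' → x l' ≠ 0 → x l ≤ x l') ∧ (∀ l, (x l : ℕ) ≤ k) ∧
      ∀ i : Fin k, (Finset.univ.filter fun l => (x l : ℕ) = i + 1).card = d i := by
  let e := finSigmaFinEquiv (n := fun i => (d i : ℕ))
  have hS : ∑ i, (d i : ℕ) ≤ L := by
    calc ∑ i, (d i : ℕ) ≤ ∑ _i : Fin k, D := Finset.sum_le_sum fun i _ => by have := (d i).2; omega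
      _ = k * D := by simp
      _ ≤ L := (Nat.mul_le_mul_right D hk).trans hL
  -- Block `i` of the concatenation lists the children of vertex `i + 1`; the remaining slots are
  -- `0`.
  let x : Fin L → Fin (K + 1) := fun l =>
    if h : (l : ℕ) < ∑ i, (d i : ℕ) then
      ⟨(e.symm ⟨l, h⟩).1 + 1, by have := (e.symm ⟨l, h⟩).1.2; omega⟩
    else 0
  have hx : ∀ (l : Fin L) (h : (l : ℕ) < ∑ i, (d i : ℕ)), (x l : ℕ) = (e.symm ⟨l, h⟩).1 + 1 := by
    intro l h
    simp only [x, dif_pos h]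
  have hx0 : ∀ l : Fin L, x l ≠ 0 ↔ (l : ℕ) < ∑ i, (d i : ℕ) := by
    intro l
    by_cases h : (l : ℕ) < ∑ i, (d i : ℕ)
    · simp only [h, iff_true, ne_eq, Fin.ext_iff, hx l h]
      simp
    · simp [x, h]
  refine ⟨x, fun l l' hl h => ?_, fun l l' hl h => ?_, fun l => ?_, fun i => ?_⟩
  · rw [hx0] at h ⊢
    exact lt_of_le_of_lt hl h
  · rw [hx0] at h
    have h' := lt_of_le_of_lt (Fin.le_def.1 hl) h
    rw [Fin.le_def, hx l h', hx l' h]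
    exact Nat.succ_le_succ (fst_finSigmaFinEquiv_symm_mono (fun i => (d i : ℕ))
      (show (⟨l, h'⟩ : Fin (∑ i, (d i : ℕ))) ≤ ⟨l', h⟩ from hl))
  · by_cases h : (l : ℕ) < ∑ i, (d i : ℕ)
    · rw [hx l h]; exact (e.symm ⟨l, h⟩).1.2
    · have : x l = 0 := by by_contra h'; exact h ((hx0 l).1 h')
      simp [this]
  · have himg : (Finset.univ.filter fun l => (x l : ℕ) = i + 1) =
        (Finset.univ : Finset (Fin (d i))).image fun j => Fin.castLE hS (e ⟨i, j⟩) := by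
      ext l
      simp only [Finset.mem_filter, Finset.mem_univ, true_and, Finset.mem_image]
      constructor
      · intro hl
        have h : (l : ℕ) < ∑ i, (d i : ℕ) := by
          rw [← hx0]; intro h0; simp [h0] at hl
        rw [hx l h] at hl
        obtain ⟨⟨v, j⟩, hv⟩ := e.surjective ⟨l, h⟩
        rw [← hv, Equiv.symm_apply_apply] at hl
        have hvi : v = i := Fin.ext (Nat.succ_injective hl)
        subst hvi
        exact ⟨j, by rw [hv]; rfl⟩
      · rintro ⟨j, rfl⟩
        rw [hx _ (by simp)]
        have : (⟨((Fin.castLE hS (e ⟨i, j⟩) : Fin L) : ℕ), by simp⟩ : Fin (∑ i, (d i : ℕ))) =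
          e ⟨i, j⟩ := Fin.ext (by simp)
        rw [this, Equiv.symm_apply_apply]
    have hinj : Function.Injective fun j : Fin (d i) => Fin.castLE hS (e ⟨i, j⟩) := fun j j' hj => by
      simpa using e.injective (Fin.castLE_injective hS hj)
    rw [himg, Finset.card_image_of_injective _ hinj, Finset.card_univ, Fintype.card_fin]

end LevelVectors

/-! ### Truncation and one-level extension of trees -/

namespace PlaneTree

variable {D : ℕ}

/-- The number of children of the vertex number `v + 1` of level `n`. -/
def childCount (T : PlaneTree D) (n v : ℕ) : ℕ :=
  (Finset.univ.filter fun l => (T.1 n l : ℕ) = v + 1).card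

theorem levelSize_le (T : PlaneTree D) (n : ℕ) : T.1.levelSize n ≤ D ^ n := by
  cases n with
  | zero => simp [LevelCode.levelSize]
  | succ n => exact (Finset.card_le_univ _).trans (by simp)

theorem sum_childCount (T : PlaneTree D) (n : ℕ) :
    ∑ v ∈ Finset.range (T.1.levelSize n), T.childCount n v = T.1.levelSize (n + 1) := by
  rw [LevelCode.levelSize, Finset.card_eq_sum_card_fiberwise (f := fun l => (T.1 n l : ℕ) - 1)
    (t := Finset.range (T.1.levelSize n))]
  · refine Finset.sum_congr rfl fun v _ => ?_
    unfold childCount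
    congr 1
    ext l
    simp only [Finset.mem_filter, Finset.mem_univ, true_and, ne_eq, Fin.ext_iff, Fin.val_zero]
    omega
  · intro l hl
    have h1 := T.2.parent_le n l
    simp only [Finset.coe_filter, Finset.mem_univ, true_and, Set.mem_ofPred_eq, ne_eq, Fin.ext_iff,
      Fin.val_zero] at hl
    simp only [Finset.coe_range, Set.mem_Iio]
    omega

theorem childCount_eq_zero (T : PlaneTree D) {n v : ℕ} (h : T.1.levelSize n ≤ v) :
    T.childCount n v = 0 := by
  unfold childCount
  rw [Finset.card_eq_zero, Finset.filter_eq_empty_iff]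
  intro l _ hl
  have := T.2.parent_le n l
  omega

theorem levelSize_eq_zero_of_le (T : PlaneTree D) {n m : ℕ} (hnm : n ≤ m)
    (h : T.1.levelSize n = 0) : T.1.levelSize m = 0 := by
  induction m, hnm using Nat.le_induction with
  | base => exact h
  | succ m _ ih => rw [← sum_childCount, ih]; simp

theorem code_eq_zero (T : PlaneTree D) {n : ℕ} (h : T.1.levelSize n = 0) {m : ℕ} (hm : n ≤ m)
    (l : Fin (D ^ (m + 1))) : T.1 m l = 0 := by
  have h1 := T.2.parent_le m l
  rw [T.levelSize_eq_zero_of_le hm h] at h1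
  exact Fin.ext (by simpa using h1)

theorem truncate_val (n : ℕ) (T : PlaneTree D) (m : ℕ) :
    (truncate n T).1 m = if m < n then T.1 m else 0 := by
  funext l
  simp only [truncate]
  split_ifs <;> rfl

theorem truncate_truncate (m n : ℕ) (T : PlaneTree D) :
    truncate m (truncate n T) = truncate (min m n) T := by
  refine Subtype.ext (funext fun j => ?_)
  simp only [truncate_val, lt_min_iff]
  split_ifs <;> simp_all

theorem truncate_truncate_of_le {m n : ℕ} (h : m ≤ n) (T : PlaneTree D) :
    truncate m (truncate n T) = truncate m T := by
  rw [truncate_truncate, min_eq_left h]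

theorem truncate_eq_self_of_levelSize (T : PlaneTree D) {n : ℕ} (h : T.1.levelSize n = 0) :
    truncate n T = T := by
  refine Subtype.ext (funext fun j => funext fun l => ?_)
  rw [truncate_val]
  split_ifs with hj
  · rfl
  · rw [T.code_eq_zero h (not_lt.1 hj)]; rfl

theorem levelSize_truncate (T : PlaneTree D) {m n : ℕ} (h : m ≤ n) :
    (truncate n T).1.levelSize m = T.1.levelSize m :=
  levelSize_trunc n T.1 h

theorem code_eq_of_truncate_eq {T T' : PlaneTree D} {n : ℕ} (h : truncate n T = truncate n T')
    {m : ℕ} (hm : m < n) : T.1 m = T'.1 m := by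
  have := congrFun (congrArg Subtype.val h) m
  simpa [truncate_val, hm] using this

theorem levelSize_eq_of_truncate_eq {T T' : PlaneTree D} {n : ℕ}
    (h : truncate n T = truncate n T') {m : ℕ} (hm : m ≤ n) :
    T.1.levelSize m = T'.1.levelSize m := by
  rw [← levelSize_truncate T hm, h, levelSize_truncate T' hm]

/-- With `exists_extension`, this puts the extensions of a neighbourhood by one level in bijection
with the choices of numbers of children at its boundary. -/
theorem truncate_succ_eq {T T' : PlaneTree D} {n : ℕ} (h : truncate n T = truncate n T')
    (hc : ∀ v, v < T.1.levelSize n → T.childCount n v = T'.childCount n v) :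
    truncate (n + 1) T = truncate (n + 1) T' := by
  refine Subtype.ext (funext fun m => ?_)
  rw [truncate_val, truncate_val]
  split_ifs with hm
  · rcases (Nat.lt_succ_iff.1 hm).lt_or_eq with hm | rfl
    · exact code_eq_of_truncate_eq h hm
    · refine levelVector_unique (T.2.initial m) (T.2.monotone m) (T'.2.initial m)
        (T'.2.monotone m) fun v hv => ?_
      obtain ⟨u, hu⟩ : ∃ u, (v : ℕ) = u + 1 :=
        Nat.exists_eq_succ_of_ne_zero fun h => hv (Fin.ext h)
      have hcc : T.childCount m u = T'.childCount m u := by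
        by_cases hlt : u < T.1.levelSize m
        · exact hc u hlt
        · rw [childCount_eq_zero T (not_lt.1 hlt), childCount_eq_zero T']
          rw [← levelSize_eq_of_truncate_eq h le_rfl]
          exact not_lt.1 hlt
      simpa only [childCount, Fin.ext_iff, hu] using hcc
  · rfl

/-- Entry `n` of the code describes level `n + 1`. It and all later entries of `t` vanish, so
overwriting entry `n` adds exactly one level. -/
theorem exists_extension (t : PlaneTree D) {n : ℕ} (ht : truncate n t = t)
    (d : Fin (t.1.levelSize n) → Fin (D + 1)) :
    ∃ T : PlaneTree D, truncate (n + 1) T = T ∧ truncate n T = t ∧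
      ∀ i : Fin (t.1.levelSize n), T.childCount n i = d i := by
  obtain ⟨x, hx0, hx1, hx2, hx3⟩ := exists_levelVector (L := D ^ (n + 1)) (t.levelSize_le n)
    (by rw [pow_succ]) d
  have htz : ∀ m, n ≤ m → t.1 m = 0 := by
    intro m hm
    rw [← ht, truncate_val, if_neg (not_lt.2 hm)]
  have hsize : ∀ m, m ≤ n →
      LevelCode.levelSize (Function.update t.1 n x) m = t.1.levelSize m := by
    intro m hm
    cases m with
    | zero => rfl
    | succ k =>
      simp only [LevelCode.levelSize]
      rw [Function.update_of_ne (by omega)]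
  refine ⟨⟨Function.update t.1 n x, ⟨fun m => ?_, fun m => ?_, fun m l => ?_, fun m v hv => ?_⟩⟩,
    ?_, ?_, ?_⟩
  · rcases eq_or_ne m n with rfl | hm
    · simpa using hx0
    · simpa [hm] using t.2.initial m
  · rcases eq_or_ne m n with rfl | hm
    · simpa using hx1
    · simpa [hm] using t.2.monotone m
  · rcases lt_trichotomy m n with hm | rfl | hm
    · rw [hsize m hm.le, Function.update_of_ne hm.ne]
      exact t.2.parent_le m l
    · rw [hsize m le_rfl, Function.update_self]
      exact hx2 l
    · rw [Function.update_of_ne hm.ne', htz m hm.le]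
      simp
  · rcases eq_or_ne m n with rfl | hm
    · rw [Function.update_self]
      obtain ⟨u, rfl⟩ := Nat.exists_eq_succ_of_ne_zero hv
      by_cases hu : u < t.1.levelSize m
      · have := hx3 ⟨u, hu⟩
        simp only at this
        rw [Nat.succ_eq_add_one, this]
        exact Nat.lt_succ_iff.1 (d _).2
      · rw [Finset.filter_eq_empty_iff.2]
        · simp
        · intro l _ hl
          have := hx2 l
          omega
    · rw [Function.update_of_ne hm]
      exact t.2.branching m v hv
  · refine Subtype.ext (funext fun m => ?_)
    rw [truncate_val]
    split_ifs with hm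
    · rfl
    · simp only
      rw [Function.update_of_ne (by omega), htz m (by omega)]
  · refine Subtype.ext (funext fun m => ?_)
    rw [truncate_val]
    split_ifs with hm
    · simp only
      rw [Function.update_of_ne hm.ne]
    · rw [htz m (not_lt.1 hm)]
  · intro i
    simp only [childCount, Function.update_self]
    exact hx3 i

end PlaneTree

/-! ### Gibbs weight of a neighbourhood -/

namespace PlaneTree

variable {D : ℕ}

/-- The number of vertices at levels below `n`. -/
def ballSize (T : PlaneTree D) (n : ℕ) : ℕ := ∑ m ∈ Finset.range n, T.1.levelSize m

/-- The product of the weights of the vertices at level `n`. -/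
def levelWeight (w : Fin (D + 1) → ℝ) (T : PlaneTree D) (n : ℕ) : ℝ :=
  ∏ i : Fin (T.1.levelSize n), w (T.deg ⟨n, i⟩)

/-- The product of the weights of the vertices at levels below `n`. -/
def ballWeight (w : Fin (D + 1) → ℝ) (T : PlaneTree D) (n : ℕ) : ℝ :=
  ∏ m ∈ Finset.range n, levelWeight w T m

theorem ballSize_succ (T : PlaneTree D) (n : ℕ) :
    T.ballSize (n + 1) = T.ballSize n + T.1.levelSize n := Finset.sum_range_succ _ _

theorem ballWeight_succ (w : Fin (D + 1) → ℝ) (T : PlaneTree D) (n : ℕ) :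
    T.ballWeight w (n + 1) = T.ballWeight w n * T.levelWeight w n := Finset.prod_range_succ _ _

theorem ballWeight_nonneg {w : Fin (D + 1) → ℝ} (hw : ∀ d, 0 ≤ w d) (T : PlaneTree D) (n : ℕ) :
    0 ≤ T.ballWeight w n :=
  Finset.prod_nonneg fun _ _ => Finset.prod_nonneg fun _ _ => hw _

theorem ballSize_eq_of_truncate_eq {T T' : PlaneTree D} {n : ℕ}
    (h : truncate n T = truncate n T') : T.ballSize n = T'.ballSize n :=
  Finset.sum_congr rfl fun _ hm => levelSize_eq_of_truncate_eq h (Finset.mem_range.1 hm).le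

theorem levelWeight_eq_of_childCount (w : Fin (D + 1) → ℝ) {T T' : PlaneTree D} {n : ℕ}
    (hs : T.1.levelSize n = T'.1.levelSize n)
    (d : Fin (T'.1.levelSize n) → Fin (D + 1))
    (hc : ∀ i : Fin (T'.1.levelSize n), T.childCount n i = d i) :
    T.levelWeight w n = ∏ i, w (d i) :=
  Fintype.prod_equiv (finCongr hs) _ _ fun i =>
    congrArg w (Fin.ext (hc (finCongr hs i)))

theorem ballWeight_eq_of_truncate_eq (w : Fin (D + 1) → ℝ) {T T' : PlaneTree D} {n : ℕ}
    (h : truncate n T = truncate n T') : T.ballWeight w n = T'.ballWeight w n := by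
  refine Finset.prod_congr rfl fun m hm => ?_
  rw [Finset.mem_range] at hm
  refine levelWeight_eq_of_childCount w (levelSize_eq_of_truncate_eq h hm.le) _ fun i => ?_
  rw [childCount, code_eq_of_truncate_eq h hm]
  rfl

/-- The vertices of a tree without vertices at level `n`. -/
def vertexEquiv (T : PlaneTree D) {n : ℕ} (h : T.1.levelSize n = 0) :
    (Σ m : Fin n, Fin (T.1.levelSize m)) ≃ T.Vertex where
  toFun v := ⟨v.1, v.2⟩
  invFun v := ⟨⟨v.1, by
    by_contra hv
    have := T.levelSize_eq_zero_of_le (not_lt.1 hv) h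
    have := v.2.2
    omega⟩, v.2⟩
  left_inv _ := rfl
  right_inv _ := rfl

theorem card_vertex (T : PlaneTree D) {n : ℕ} (h : T.1.levelSize n = 0) :
    ENat.card T.Vertex = T.ballSize n := by
  rw [← ENat.card_congr (T.vertexEquiv h), ENat.card_eq_coe_fintype_card, Fintype.card_sigma,
    ballSize, Finset.sum_range]
  simp

theorem ballSize_le_card_vertex (T : PlaneTree D) (n : ℕ) :
    (T.ballSize n : ℕ∞) ≤ ENat.card T.Vertex := by
  have : (T.ballSize n : ℕ∞) = ENat.card (Σ m : Fin n, Fin (T.1.levelSize m)) := by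
    rw [ENat.card_eq_coe_fintype_card, Fintype.card_sigma, ballSize, Finset.sum_range]
    simp
  rw [this]
  refine ENat.card_le_card_of_injective (f := fun v => (⟨v.1, v.2⟩ : T.Vertex)) ?_
  rintro ⟨⟨m, hm⟩, i⟩ ⟨⟨m', hm'⟩, i'⟩ h
  simp only [Sigma.mk.injEq] at h
  obtain ⟨rfl, h⟩ := h
  obtain rfl := eq_of_heq h
  rfl

theorem exp_energy (E : Fin (D + 1) → ℝ) (β : ℝ) (T : PlaneTree D) {n : ℕ}
    (h : T.1.levelSize n = 0) :
    Real.exp (-β * energy E T) = T.ballWeight (fun d => Real.exp (-β * E d)) n := by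
  have : energy E T = ∑ m ∈ Finset.range n, ∑ i : Fin (T.1.levelSize m), E (T.deg ⟨m, i⟩) := by
    rw [energy, ← finsum_comp_equiv (T.vertexEquiv h), finsum_eq_sum_of_fintype,
      Fintype.sum_sigma, Finset.sum_range]
    rfl
  rw [this, ballWeight, Finset.mul_sum, Real.exp_sum]
  refine Finset.prod_congr rfl fun m _ => ?_
  rw [levelWeight, Finset.mul_sum, Real.exp_sum]

theorem le_ballSize (T : PlaneTree D) {n : ℕ} (h : T.1.levelSize n ≠ 0) : n ≤ T.ballSize n := by
  calc n = ∑ _m ∈ Finset.range n, 1 := by simp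
    _ ≤ _ := Finset.sum_le_sum fun m hm => by
      rw [Nat.one_le_iff_ne_zero]
      exact fun h' => h (T.levelSize_eq_zero_of_le (Finset.mem_range.1 hm).le h')

/-- A vertex at level `N` would have an ancestor at each of the levels `0, …, N`, too many for `N`
vertices. -/
theorem levelSize_eq_zero_of_mem_ofOrder {T : PlaneTree D} {N : ℕ} (hT : T ∈ ofOrder D N) :
    T.1.levelSize N = 0 := by
  by_contra h
  have h1 := T.ballSize_le_card_vertex (N + 1)
  rw [show ENat.card T.Vertex = N from hT, Nat.cast_le, ballSize_succ] at h1
  have := T.le_ballSize h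
  omega

theorem finite_setOf_truncate_eq_self (D n : ℕ) :
    {T : PlaneTree D | truncate n T = T}.Finite := by
  let f : PlaneTree D → (m : Fin n) → Fin (D ^ (m.1 + 1)) → Fin (D ^ m.1 + 1) := fun T m => T.1 m
  refine Set.Finite.of_finite_image (f := f) (Set.toFinite _) ?_
  intro T hT T' hT' h
  rw [← show truncate n T = T from hT, ← show truncate n T' = T' from hT']
  refine Subtype.ext (funext fun m => ?_)
  rw [truncate_val, truncate_val]
  split_ifs with hm
  · exact congrFun h ⟨m, hm⟩
  · rfl

instance finite_ofOrder (N : ℕ) : Finite (ofOrder D N) :=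
  ((finite_setOf_truncate_eq_self D N).subset fun T hT =>
    T.truncate_eq_self_of_levelSize (levelSize_eq_zero_of_mem_ofOrder hT)).to_subtype

/-- The unnormalised Gibbs measure on trees with `N` vertices. -/
def gibbsWeight (E : Fin (D + 1) → ℝ) (β : ℝ) (N : ℕ) : Measure (PlaneTree D) :=
  Measure.sum fun T : ofOrder D N =>
    ENNReal.ofReal (Real.exp (-β * energy E T.1)) • Measure.dirac T.1

theorem gibbsWeight_eq_zero (E : Fin (D + 1) → ℝ) (β : ℝ) (N : ℕ) {A : Set (PlaneTree D)}
    (hA : MeasurableSet A) (h : ∀ T ∈ A, T ∉ ofOrder D N) : gibbsWeight E β N A = 0 := by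
  rw [gibbsWeight, Measure.sum_apply _ hA, ENNReal.tsum_eq_zero]
  intro T
  rw [Measure.smul_apply, Measure.dirac_apply' _ hA, Set.indicator_of_notMem, smul_zero]
  exact fun hT => h _ hT T.2

theorem gibbsWeight_singleton (E : Fin (D + 1) → ℝ) (β : ℝ) {N : ℕ} {T : PlaneTree D}
    (hT : T ∈ ofOrder D N) :
    gibbsWeight E β N {T} = ENNReal.ofReal (Real.exp (-β * energy E T)) := by
  rw [gibbsWeight, Measure.sum_apply _ (measurableSet_singleton T),
    tsum_eq_single (⟨T, hT⟩ : ofOrder D N)]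
  · simp
  · intro T' hT'
    rw [Measure.smul_apply, Measure.dirac_apply, Set.indicator_of_notMem, smul_zero]
    exact fun h => hT' (Subtype.ext h)

theorem measurableSet_setOf_truncate_eq (n : ℕ) (t : PlaneTree D) :
    MeasurableSet {T : PlaneTree D | truncate n T = t} :=
  measurable_truncate n (measurableSet_singleton t)

/-- The weight of the trees with a given neighbourhood of the root, in terms of the weight of the
forest that is left after the neighbourhood is removed. -/
theorem gibbsWeight_setOf_truncate_eq (E : Fin (D + 1) → ℝ) (β : ℝ) (N : ℕ) {n : ℕ}
    {t : PlaneTree D} (ht : truncate n t = t) :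
    gibbsWeight E β (t.ballSize n + N) {T | truncate n T = t} =
      ENNReal.ofReal (t.ballWeight (fun d => Real.exp (-β * E d)) n *
        forestWeight (fun d => Real.exp (-β * E d)) N (t.1.levelSize n)) := by
  set w : Fin (D + 1) → ℝ := fun d => Real.exp (-β * E d) with hw
  have hw0 : ∀ d, 0 ≤ w d := fun d => (Real.exp_pos _).le
  -- Enlarging the radius by one moves the level-`n` vertices from the forest into the
  -- neighbourhood, which lowers `N`; hence `n` and `t` must vary.
  induction N using Nat.strong_induction_on generalizing n t with
  | _ N ih =>
  rcases Nat.eq_zero_or_pos (t.1.levelSize n) with h0 | hpos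
  -- With nothing at level `n`, the neighbourhood is already the whole tree.
  · have hset : {T : PlaneTree D | truncate n T = t} = {t} := by
      ext T
      refine ⟨fun hT => ?_, fun hT => by rw [hT]; exact ht⟩
      have hT0 : T.1.levelSize n = 0 := by
        rw [← h0]
        exact levelSize_eq_of_truncate_eq ((show truncate n T = t from hT).trans ht.symm) le_rfl
      exact (T.truncate_eq_self_of_levelSize hT0).symm.trans hT
    rw [hset, h0]
    have hcard := t.card_vertex h0
    rcases Nat.eq_zero_or_pos N with rfl | hN
    · rw [add_zero, gibbsWeight_singleton E β (show t ∈ ofOrder D _ from hcard),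
        exp_energy E β t h0, forestWeight_zero_left]
      simp [hw]
    · obtain ⟨M, rfl⟩ := Nat.exists_eq_succ_of_ne_zero hN.ne'
      rw [Nat.succ_eq_add_one, forestWeight_succ_zero, mul_zero, ENNReal.ofReal_zero]
      refine gibbsWeight_eq_zero E β _ (measurableSet_singleton t) ?_
      rintro T rfl hT
      rw [ofOrder, Set.mem_ofPred_eq, hcard, Nat.cast_inj] at hT
      omega
  · rcases lt_or_ge N (t.1.levelSize n) with hlt | hge
    · rw [forestWeight_of_lt w hlt, mul_zero, ENNReal.ofReal_zero]
      refine gibbsWeight_eq_zero E β _ (measurableSet_setOf_truncate_eq n t) ?_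
      intro T hT hT'
      have hTt : truncate n T = truncate n t := (show truncate n T = t from hT).trans ht.symm
      have h1 := T.ballSize_le_card_vertex (n + 1)
      rw [show ENat.card T.Vertex = _ from hT', Nat.cast_le, ballSize_succ,
        ballSize_eq_of_truncate_eq hTt, levelSize_eq_of_truncate_eq hTt le_rfl] at h1
      omega
    · obtain ⟨M, rfl⟩ := Nat.exists_eq_add_of_le' hge
      choose e he1 he2 he3 using exists_extension t ht
      have het : ∀ d, truncate n (e d) = truncate n t := fun d => (he2 d).trans ht.symm
      have hset : {T : PlaneTree D | truncate n T = t} =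
          ⋃ d, {T : PlaneTree D | truncate (n + 1) T = e d} := by
        ext T
        simp only [Set.mem_ofPred_eq, Set.mem_iUnion]
        constructor
        · intro hT
          have hTt : truncate n T = truncate n t := hT.trans ht.symm
          have hs := levelSize_eq_of_truncate_eq hTt le_rfl
          refine ⟨fun i => T.deg ⟨n, finCongr hs.symm i⟩, ?_⟩
          rw [← he1]
          refine truncate_succ_eq (hTt.trans (het _).symm) fun v hv => ?_
          rw [he3 _ ⟨v, hs ▸ hv⟩]
          rfl
        · rintro ⟨d, hd⟩
          rw [← truncate_truncate_of_le n.le_succ, hd, he2]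
      have hdisj : Pairwise (Function.onFun Disjoint
          fun d => {T : PlaneTree D | truncate (n + 1) T = e d}) := by
        intro d d' hdd
        refine Set.disjoint_left.2 fun T hT hT' => hdd ?_
        have hee : e d = e d' := (show _ = _ from hT).symm.trans hT'
        funext i
        refine Fin.ext ?_
        rw [← he3 d, ← he3 d', hee]
      have hsize : ∀ d, (e d).ballSize (n + 1) = t.ballSize n + t.1.levelSize n := by
        intro d
        rw [ballSize_succ, ballSize_eq_of_truncate_eq (het d),
          levelSize_eq_of_truncate_eq (het d) le_rfl]
      have hlevel : ∀ d, (e d).1.levelSize (n + 1) = ∑ i, (d i : ℕ) := by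
        intro d
        rw [← sum_childCount, levelSize_eq_of_truncate_eq (het d) le_rfl, Finset.sum_range]
        exact Finset.sum_congr rfl fun i _ => he3 d i
      have hweight : ∀ d, (e d).ballWeight w (n + 1) = t.ballWeight w n * ∏ i, w (d i) := by
        intro d
        rw [ballWeight_succ, ballWeight_eq_of_truncate_eq w (het d),
          levelWeight_eq_of_childCount w (levelSize_eq_of_truncate_eq (het d) le_rfl) d (he3 d)]
      rw [hset, measure_iUnion hdisj fun d => measurableSet_setOf_truncate_eq _ _, tsum_fintype,
        forestWeight_add_self, Finset.mul_sum, ENNReal.ofReal_sum_of_nonneg]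
      · refine Finset.sum_congr rfl fun d _ => ?_
        have := ih M (by omega) (he1 d)
        rw [hsize, hlevel, hweight] at this
        rw [show t.ballSize n + (M + t.1.levelSize n) = t.ballSize n + t.1.levelSize n + M by ring,
          this, mul_assoc]
      · intro d _
        exact mul_nonneg (ballWeight_nonneg hw0 _ _) (mul_nonneg (Finset.prod_nonneg fun _ _ => hw0 _)
          (forestWeight_nonneg w hw0 _ _))

end PlaneTree

/-! ### Total variation on a finite set -/

theorem tvDist_le_sum {Ω : Type*} [MeasurableSpace Ω] [MeasurableSingletonClass Ω]
    {μ ν : Measure Ω} (F : Finset Ω) (hμ : μ (F : Set Ω)ᶜ = 0) (hν : ν (F : Set Ω)ᶜ = 0) :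
    tvDist μ ν ≤ ∑ t ∈ F, ((μ {t} - ν {t}) + (ν {t} - μ {t})) := by
  classical
  have hsum : ∀ ρ : Measure Ω, ρ (F : Set Ω)ᶜ = 0 → ∀ A : Set Ω,
      ρ A = ∑ t ∈ F.filter (· ∈ A), ρ {t} := by
    intro ρ hρ A
    rw [sum_measure_singleton]
    refine le_antisymm ?_ (measure_mono fun t ht => by simpa using (Finset.mem_filter.1 ht).2)
    calc ρ A ≤ ρ ((F.filter (· ∈ A) : Finset Ω) ∪ (F : Set Ω)ᶜ) := measure_mono fun t ht => by
          by_cases h : t ∈ F <;> simp [h, ht]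
      _ ≤ _ := (measure_union_le _ _).trans (by rw [hρ, add_zero])
  have hsub : ∀ ρ σ : Measure Ω, ρ (F : Set Ω)ᶜ = 0 → σ (F : Set Ω)ᶜ = 0 → ∀ A : Set Ω,
      ρ A - σ A ≤ ∑ t ∈ F, (ρ {t} - σ {t}) := by
    intro ρ σ hρ hσ A
    rw [tsub_le_iff_right, hsum ρ hρ A, hsum σ hσ A]
    calc ∑ t ∈ F.filter (· ∈ A), ρ {t} ≤ ∑ t ∈ F.filter (· ∈ A), ((ρ {t} - σ {t}) + σ {t}) :=
          Finset.sum_le_sum fun _ _ => le_tsub_add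
      _ ≤ _ := by
          rw [Finset.sum_add_distrib]
          gcongr
          exact Finset.filter_subset _ _
  refine iSup₂_le fun A _ => ?_
  rw [Finset.sum_add_distrib]
  exact max_le ((hsub μ ν hμ hν A).trans le_self_add) ((hsub ν μ hν hμ A).trans le_add_self)

/-- On a finite set, pointwise convergence implies convergence in total variation. -/
theorem tendsto_tvDist_of_tendsto_singleton {Ω : Type*} [MeasurableSpace Ω]
    [MeasurableSingletonClass Ω] {μ : ℕ → Measure Ω} {ν : Measure Ω} [IsFiniteMeasure ν]
    (F : Finset Ω) (hμ : ∀ N, μ N (F : Set Ω)ᶜ = 0) (hν : ν (F : Set Ω)ᶜ = 0)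
    (h : ∀ t ∈ F, Tendsto (fun N => μ N {t}) atTop (𝓝 (ν {t}))) :
    Tendsto (fun N => tvDist (μ N) ν) atTop (𝓝 0) := by
  have hlim : Tendsto (fun N => ∑ t ∈ F, ((μ N {t} - ν {t}) + (ν {t} - μ N {t}))) atTop (𝓝 0) := by
    have : ∀ t ∈ F, Tendsto (fun N => (μ N {t} - ν {t}) + (ν {t} - μ N {t})) atTop (𝓝 0) := by
      intro t ht
      -- Subtraction in `ℝ≥0∞` is not continuous at `(∞, ∞)`.
      have hfin : ν {t} ≠ ∞ := measure_ne_top ν _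
      have h1 := ENNReal.Tendsto.sub (h t ht) tendsto_const_nhds (Or.inr hfin)
      have h2 := ENNReal.Tendsto.sub tendsto_const_nhds (h t ht) (Or.inl hfin)
      simpa using h1.add h2
    simpa using tendsto_finsetSum F this
  exact tendsto_of_tendsto_of_tendsto_of_le_of_le tendsto_const_nhds hlim (fun _ => zero_le)
    fun N => tvDist_le_sum F (hμ N) hν

/-! ### The local limit and its uniqueness -/

namespace PlaneTree

variable {D : ℕ}

/-- The trees of height at most `n`. -/
def ballFinset (D n : ℕ) : Finset (PlaneTree D) := (finite_setOf_truncate_eq_self D n).toFinset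

theorem mem_ballFinset {n : ℕ} {T : PlaneTree D} : T ∈ ballFinset D n ↔ truncate n T = T := by
  simp [ballFinset]

theorem truncate_mem_ballFinset (n : ℕ) (T : PlaneTree D) : truncate n T ∈ ballFinset D n := by
  rw [mem_ballFinset, truncate_truncate_of_le le_rfl]

theorem map_truncate_compl_ballFinset (μ : Measure (PlaneTree D)) (n : ℕ) :
    μ.map (truncate n) (ballFinset D n : Set (PlaneTree D))ᶜ = 0 := by
  rw [Measure.map_apply (measurable_truncate n) (Finset.measurableSet _).compl]
  convert measure_empty (μ := μ)
  ext T
  simpa using truncate_mem_ballFinset n T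

theorem map_truncate_singleton (μ : Measure (PlaneTree D)) (n : ℕ) (t : PlaneTree D) :
    μ.map (truncate n) {t} = μ {T | truncate n T = t} :=
  Measure.map_apply (measurable_truncate n) (measurableSet_singleton t)

/-- The tree that consists of the root alone. -/
def root (D : ℕ) : PlaneTree D :=
  ⟨fun _ _ => 0, ⟨by simp, by simp, by simp, fun n v hv => by simp [hv.symm]⟩⟩

/-- Radius `0` imposes no condition: every neighbourhood is the bare root, so the total mass is the
weight of a one-tree forest. -/
theorem gibbsWeight_univ (E : Fin (D + 1) → ℝ) (β : ℝ) (N : ℕ) :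
    gibbsWeight E β N Set.univ =
      ENNReal.ofReal (forestWeight (fun d => Real.exp (-β * E d)) N 1) := by
  have h0 : ∀ T : PlaneTree D, truncate 0 T = root D := fun T => by
    refine Subtype.ext (funext fun m => ?_)
    rw [truncate_val]
    rfl
  have := gibbsWeight_setOf_truncate_eq E β N (h0 (root D))
  have hset : {T : PlaneTree D | truncate 0 T = root D} = Set.univ := by
    ext T; simp [h0]
  rw [hset] at this
  simpa [ballSize, ballWeight, LevelCode.levelSize] using this

theorem partitionFunction_eq (E : Fin (D + 1) → ℝ) (β : ℝ) (N : ℕ) :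
    partitionFunction E β N = forestWeight (fun d => Real.exp (-β * E d)) N 1 := by
  have := Fintype.ofFinite (ofOrder D N)
  rw [← ENNReal.ofReal_eq_ofReal_iff _ (forestWeight_nonneg _ (fun d => (Real.exp_pos _).le) _ _),
    ← gibbsWeight_univ, gibbsWeight, Measure.sum_apply _ MeasurableSet.univ, partitionFunction,
    finsum_eq_sum_of_fintype, tsum_fintype, ENNReal.ofReal_sum_of_nonneg]
  · simp
  · exact fun _ _ => (Real.exp_pos _).le
  · exact finsum_nonneg fun _ => (Real.exp_pos _).le

theorem partitionFunction_pos (hD : 1 ≤ D) (E : Fin (D + 1) → ℝ) (β : ℝ) (N : ℕ) :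
    0 < partitionFunction E β (N + 1) := by
  rw [partitionFunction_eq]
  exact forestWeight_one_pos _ hD (fun d => Real.exp_pos _) N

theorem gibbs_eq_smul (hD : 1 ≤ D) (E : Fin (D + 1) → ℝ) (β : ℝ) {N : ℕ} (hN : N ≠ 0) :
    gibbs E β N = (ENNReal.ofReal (partitionFunction E β N))⁻¹ • gibbsWeight E β N := by
  obtain ⟨M, rfl⟩ := Nat.exists_eq_succ_of_ne_zero hN
  have hZ := partitionFunction_pos hD E β M
  refine Measure.ext fun A hA => ?_
  rw [Measure.smul_apply, gibbs, gibbsWeight, Measure.sum_apply _ hA, Measure.sum_apply _ hA,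
    smul_eq_mul, ← ENNReal.tsum_mul_left]
  refine tsum_congr fun T => ?_
  rw [Measure.smul_apply, Measure.smul_apply, smul_eq_mul, smul_eq_mul, ← mul_assoc,
    ENNReal.ofReal_div_of_pos hZ, ENNReal.div_eq_inv_mul]

theorem isProbabilityMeasure_gibbs (hD : 1 ≤ D) (E : Fin (D + 1) → ℝ) (β : ℝ) {N : ℕ}
    (hN : N ≠ 0) : IsProbabilityMeasure (gibbs E β N) := by
  constructor
  obtain ⟨M, rfl⟩ := Nat.exists_eq_succ_of_ne_zero hN
  have hZ := partitionFunction_pos hD E β M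
  rw [gibbs_eq_smul hD E β hN, Measure.smul_apply, gibbsWeight_univ, ← partitionFunction_eq,
    smul_eq_mul]
  exact ENNReal.inv_mul_cancel (ENNReal.ofReal_pos.2 hZ).ne' ENNReal.ofReal_ne_top

theorem gibbs_setOf_truncate_eq (hD : 1 ≤ D) (E : Fin (D + 1) → ℝ) (β : ℝ) (N : ℕ) {n : ℕ}
    {t : PlaneTree D} (ht : truncate n t = t) (hN : N ≠ 0) :
    gibbs E β (N + t.ballSize n) {T | truncate n T = t} =
      ENNReal.ofReal (t.ballWeight (fun d => Real.exp (-β * E d)) n *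
        (forestWeight (fun d => Real.exp (-β * E d)) N (t.1.levelSize n) /
          forestWeight (fun d => Real.exp (-β * E d)) (N + t.ballSize n) 1)) := by
  obtain ⟨M, rfl⟩ := Nat.exists_eq_succ_of_ne_zero hN
  rw [gibbs_eq_smul hD E β (by omega), Measure.smul_apply, partitionFunction_eq,
    add_comm _ (t.ballSize n), gibbsWeight_setOf_truncate_eq E β _ ht, ← mul_div_assoc,
    ENNReal.ofReal_div_of_pos, smul_eq_mul, ENNReal.div_eq_inv_mul]
  exact forestWeight_one_pos _ hD (fun d => Real.exp_pos _) (t.ballSize n + M)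

/-- The probability of each neighbourhood of the root converges. -/
theorem exists_tendsto_gibbs (hD : 1 ≤ D) (E : Fin (D + 1) → ℝ) (β : ℝ) {n : ℕ}
    {t : PlaneTree D} (ht : truncate n t = t) :
    ∃ c, Tendsto (fun N => gibbs E β N {T | truncate n T = t}) atTop (𝓝 c) := by
  obtain ⟨c, hc⟩ := exists_tendsto_forestWeight_div (fun d => Real.exp (-β * E d)) hD
    (fun d => Real.exp_pos _) (t.1.levelSize n) (t.ballSize n)
    -- For `D = 1` a level has at most `1 ^ n = 1` vertex.
    (by rintro rfl; simpa using t.levelSize_le n)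
  refine ⟨_, (tendsto_add_atTop_iff_nat (t.ballSize n)).1
    ((ENNReal.tendsto_ofReal (hc.const_mul
      (t.ballWeight (fun d => Real.exp (-β * E d)) n))).congr' ?_)⟩
  filter_upwards [eventually_ne_atTop 0] with N hN
  rw [gibbs_setOf_truncate_eq hD E β N ht hN]

/-- A neighbourhood of the root without vertices at its boundary is a whole tree, which has
probability `0` in the limit. -/
theorem tendsto_gibbs_zero (hD : 1 ≤ D) (E : Fin (D + 1) → ℝ) (β : ℝ) {n : ℕ}
    {t : PlaneTree D} (ht : truncate n t = t) (h0 : t.1.levelSize n = 0) :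
    Tendsto (fun N => gibbs E β N {T | truncate n T = t}) atTop (𝓝 0) := by
  refine (tendsto_add_atTop_iff_nat (t.ballSize n)).1 (tendsto_const_nhds.congr' ?_)
  filter_upwards [eventually_ne_atTop 0] with N hN
  obtain ⟨M, rfl⟩ := Nat.exists_eq_succ_of_ne_zero hN
  rw [gibbs_setOf_truncate_eq hD E β _ ht hN, h0, Nat.succ_eq_add_one, forestWeight_succ_zero]
  simp

theorem continuous_levelSize (n : ℕ) :
    Continuous fun x : LevelCode D => x.levelSize n := by
  cases n with
  | zero => exact continuous_const
  | succ n =>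
    have : (fun x : LevelCode D => x.levelSize (n + 1)) =
        (fun y : Fin (D ^ (n + 1)) → Fin (D ^ n + 1) => (Finset.univ.filter fun l => y l ≠ 0).card) ∘
          fun x : LevelCode D => x n := rfl
    rw [this]
    exact continuous_of_discreteTopology.comp (continuous_apply n)

/-- Each condition at each level reads finitely many discrete coordinates. Closedness makes the tree
space compact, inside a product of finite spaces. -/
theorem isClosed_setOf_isPlaneTree : IsClosed {x : LevelCode D | x.IsPlaneTree} := by
  have hset : {x : LevelCode D | x.IsPlaneTree} =
      (⋂ n, ((fun x : LevelCode D => x n) ⁻¹' {y | ∀ l l', l ≤ l' → y l' ≠ 0 → y l ≠ 0})) ∩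
      (⋂ n, ((fun x : LevelCode D => x n) ⁻¹' {y | ∀ l l', l ≤ l' → y l' ≠ 0 → y l ≤ y l'})) ∩
      (⋂ n, ((fun x : LevelCode D => (x n, x.levelSize n)) ⁻¹' {y | ∀ l, (y.1 l : ℕ) ≤ y.2})) ∩
      (⋂ n, ((fun x : LevelCode D => x n) ⁻¹'
        {y | ∀ v : ℕ, v ≠ 0 → (Finset.univ.filter fun l => (y l : ℕ) = v).card ≤ D})) := by
    ext x
    simp only [Set.mem_inter_iff, Set.mem_iInter, Set.mem_preimage, Set.mem_ofPred_eq]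
    exact ⟨fun h => ⟨⟨⟨h.initial, h.monotone⟩, h.parent_le⟩, h.branching⟩,
      fun h => ⟨h.1.1.1, h.1.1.2, h.1.2, h.2⟩⟩
  rw [hset]
  refine ((IsClosed.inter ?_ ?_).inter ?_).inter ?_ <;> refine isClosed_iInter fun n => ?_
  · exact (isClosed_discrete _).preimage (continuous_apply n)
  · exact (isClosed_discrete _).preimage (continuous_apply n)
  · exact (isClosed_discrete _).preimage ((continuous_apply n).prodMk (continuous_levelSize n))
  · exact (isClosed_discrete _).preimage (continuous_apply n)

instance compactSpace : CompactSpace (PlaneTree D) :=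
  isCompact_iff_compactSpace.1 isClosed_setOf_isPlaneTree.isCompact

theorem isClopen_setOf_truncate_eq {n : ℕ} {t : PlaneTree D} (ht : truncate n t = t) :
    IsClopen {T : PlaneTree D | truncate n T = t} := by
  let f : PlaneTree D → (m : Fin n) → Fin (D ^ (m.1 + 1)) → Fin (D ^ m.1 + 1) := fun T m => T.1 m
  have hf : Continuous f :=
    continuous_pi fun m => (continuous_apply m.1).comp continuous_subtype_val
  have hset : {T : PlaneTree D | truncate n T = t} = f ⁻¹' {f t} := by
    ext T
    simp only [Set.mem_ofPred_eq, Set.mem_preimage, Set.mem_singleton_iff]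
    constructor
    · intro h
      exact funext fun m => code_eq_of_truncate_eq (h.trans ht.symm) m.2
    · intro h
      rw [← ht]
      refine Subtype.ext (funext fun m => ?_)
      rw [truncate_val, truncate_val]
      split_ifs with hm
      · exact congrFun h ⟨m, hm⟩
      · rfl
  rw [hset]
  exact (isClopen_discrete _).preimage hf

/-- The local limit of the Gibbs distributions. -/
theorem exists_local_limit (hD : 1 ≤ D) (E : Fin (D + 1) → ℝ) (β : ℝ) :
    ∃ P : Measure (PlaneTree D), IsProbabilityMeasure P ∧
      ∀ n, ∀ t : PlaneTree D, truncate n t = t →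
        Tendsto (fun N => gibbs E β N {T | truncate n T = t}) atTop
          (𝓝 (P {T | truncate n T = t})) := by
  -- The shift avoids `N = 0`, for which there are no trees.
  let g : ℕ → ProbabilityMeasure (PlaneTree D) := fun N =>
    ⟨gibbs E β (N + 1), isProbabilityMeasure_gibbs hD E β N.succ_ne_zero⟩
  have : TopologicalSpace.MetrizableSpace (PlaneTree D) :=
    Topology.IsEmbedding.subtypeVal.metrizableSpace
  let _ := TopologicalSpace.metrizableSpaceMetric (PlaneTree D)
  -- Probability measures on a compact metrizable space form a compact space; the ultrafilter plays
  -- the role of a convergent subsequence.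
  obtain ⟨P, hP⟩ := exists_clusterPt_of_compactSpace (map g atTop)
  obtain ⟨U, hU, hUP⟩ := mapClusterPt_iff_ultrafilter.1 hP
  refine ⟨P, inferInstance, fun n t ht => ?_⟩
  obtain ⟨c, hc⟩ := exists_tendsto_gibbs hD E β ht
  have h1 : Tendsto (fun N => (g N : Measure (PlaneTree D)) {T | truncate n T = t}) U
      (𝓝 ((P : Measure (PlaneTree D)) {T | truncate n T = t})) :=
    ProbabilityMeasure.tendsto_measure_of_null_frontier_of_tendsto' hUP
      (by rw [(isClopen_setOf_truncate_eq ht).frontier_eq, measure_empty])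
  -- The full sequence converges on each cylinder, so the limit along the ultrafilter is the limit.
  have h2 : Tendsto (fun N => (g N : Measure (PlaneTree D)) {T | truncate n T = t}) U (𝓝 c) :=
    (hc.comp (tendsto_add_atTop_nat 1)).mono_left hU
  rwa [tendsto_nhds_unique h1 h2]

theorem mem_ofHeight_iff {n : ℕ} {T : PlaneTree D} :
    T ∈ ofHeight D n ↔ T.1.levelSize n ≠ 0 ∧ T.1.levelSize (n + 1) = 0 := by
  constructor
  · rintro ⟨⟨v, hv⟩, hle⟩
    constructor
    · intro h0
      have := v.2.2
      rw [show T.height v = v.1 from rfl] at hv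
      subst hv
      omega
    · by_contra h
      have := hle ⟨⟨n + 1, ⟨0, Nat.pos_of_ne_zero h⟩⟩, rfl⟩
      simp [height] at this
  · rintro ⟨h1, h2⟩
    refine ⟨⟨⟨n, ⟨0, Nat.pos_of_ne_zero h1⟩⟩, rfl⟩, ?_⟩
    rintro _ ⟨v, rfl⟩
    by_contra h
    have h3 := T.levelSize_eq_zero_of_le (show n + 1 ≤ v.1 from not_le.1 h) h2
    have := v.2.2
    omega

theorem measurableSet_ofHeight (n : ℕ) : MeasurableSet (ofHeight D n) :=
  ((finite_setOf_truncate_eq_self D (n + 1)).subset fun _ hT =>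
    truncate_eq_self_of_levelSize _ (mem_ofHeight_iff.1 hT).2).measurableSet

theorem truncate_mem_ofHeight {n : ℕ} {T : PlaneTree D} (h : T.1.levelSize n ≠ 0) :
    truncate n T ∈ ofHeight D n := by
  rw [mem_ofHeight_iff, levelSize_truncate T le_rfl]
  refine ⟨h, ?_⟩
  simp [LevelCode.levelSize, truncate_val]

/-- A measure on the space of trees is determined by the laws of the neighbourhoods of the
root. -/
theorem ext_of_map_truncate {P Q : Measure (PlaneTree D)} [IsFiniteMeasure P]
    (h : ∀ n, 1 ≤ n → Q.map (truncate n) = P.map (truncate n)) : Q = P := by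
  let C : Set (Set (PlaneTree D)) :=
    {s | ∃ n, 1 ≤ n ∧ ∃ A, MeasurableSet A ∧ truncate n ⁻¹' A = s}
  have happly : ∀ n, 1 ≤ n → ∀ A, MeasurableSet A → P (truncate n ⁻¹' A) = Q (truncate n ⁻¹' A) := by
    intro n hn A hA
    rw [← Measure.map_apply (measurable_truncate n) hA, ← h n hn,
      Measure.map_apply (measurable_truncate n) hA]
  symm
  refine ext_of_generate_finite C (le_antisymm ?_ ?_) ?_ ?_ ?_
  · refine MeasurableSpace.comap_le_iff_le_map.2 ?_
    refine iSup_le fun m => MeasurableSpace.comap_le_iff_le_map.2 ?_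
    refine iSup_le fun l => MeasurableSpace.comap_le_iff_le_map.2 ?_
    intro s hs
    -- Coordinate `m` survives truncation at radius `m + 1`.
    refine MeasurableSpace.measurableSet_generateFrom
      ⟨m + 1, by omega, {T | T.1 m l ∈ s}, ?_, ?_⟩
    · exact ((measurable_pi_apply l).comp ((measurable_pi_apply m).comp measurable_subtype_coe)) hs
    · ext T
      simp [truncate_val]
  · refine MeasurableSpace.generateFrom_le ?_
    rintro _ ⟨n, -, A, hA, rfl⟩
    exact measurable_truncate n hA
  · rintro _ ⟨n, hn, A, hA, rfl⟩ _ ⟨m, -, B, hB, rfl⟩ -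
    refine ⟨max n m, le_max_of_le_left hn, truncate n ⁻¹' A ∩ truncate m ⁻¹' B,
      (measurable_truncate n hA).inter (measurable_truncate m hB), ?_⟩
    ext T
    simp [truncate_truncate_of_le]
  · rintro _ ⟨n, hn, A, hA, rfl⟩
    exact happly n hn A hA
  -- Total masses agree through radius `1`, so `Q` need not be assumed finite.
  · simpa using happly 1 le_rfl Set.univ MeasurableSet.univ

end PlaneTree

end

open PlaneTree in
theorem theorem6 (D : ℕ) (hD : 1 ≤ D) (E : Fin (D + 1) → ℝ) (β : ℝ) :
    ∃ P : (n : ℕ) → Measure (PlaneTree.ofHeight D n),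
      (∀ n : ℕ, 1 ≤ n → IsLimitLaw E β n (P n)) ∧
      ∃ Pinf : Measure (PlaneTree D),
        IsConsistent P Pinf ∧
        (∀ Q : Measure (PlaneTree D), IsConsistent P Q → Q = Pinf) ∧
        Pinf (PlaneTree.infinite D)ᶜ = 0 := by
  obtain ⟨Pinf, hprob, hlim⟩ := exists_local_limit hD E β
  -- Finitely many neighbourhoods have an empty level `n`, and each has limiting probability `0`.
  have hzero : ∀ n, Pinf {T | T.1.levelSize n = 0} = 0 := by
    intro n
    have hsub : {T : PlaneTree D | T.1.levelSize n = 0} ⊆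
        ⋃ t ∈ {t | truncate n t = t ∧ t.1.levelSize n = 0}, {T | truncate n T = t} := by
      intro T hT
      simp only [Set.mem_iUnion]
      exact ⟨truncate n T, ⟨truncate_truncate_of_le le_rfl T,
        (levelSize_truncate T le_rfl).trans hT⟩, rfl⟩
    refine measure_mono_null hsub ((measure_biUnion_null_iff
      ((finite_setOf_truncate_eq_self D n).subset fun t ht => ht.1).countable).2 ?_)
    rintro t ⟨ht, h0⟩
    exact tendsto_nhds_unique (hlim n t ht) (tendsto_gibbs_zero hD E β ht h0)
  -- Passing to the trees of height `n` and back loses no mass: a truncation misses that set only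
  -- when level `n` is empty.
  have hmap : ∀ n, ((Pinf.map (truncate n)).comap (Subtype.val : ofHeight D n → PlaneTree D)).map
      Subtype.val = Pinf.map (truncate n) := by
    intro n
    rw [(MeasurableEmbedding.subtype_coe (measurableSet_ofHeight n)).map_comap, Subtype.range_coe]
    refine Measure.restrict_eq_self_of_ae_mem ?_
    rw [ae_iff]
    change Pinf.map (truncate n) (ofHeight D n)ᶜ = 0
    rw [Measure.map_apply (measurable_truncate n) (measurableSet_ofHeight n).compl]
    refine measure_mono_null (fun T hT => ?_) (hzero n)
    by_contra h
    exact hT (truncate_mem_ofHeight h)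
  refine ⟨fun n => (Pinf.map (truncate n)).comap Subtype.val, fun n _ => ?_, Pinf,
    fun n _ => (hmap n).symm, fun Q hQ => ?_, ?_⟩
  · rw [IsLimitLaw, hmap]
    refine tendsto_tvDist_of_tendsto_singleton (ballFinset D n)
      (fun N => map_truncate_compl_ballFinset _ n) (map_truncate_compl_ballFinset _ n)
      fun t ht => ?_
    simp only [map_truncate_singleton]
    exact hlim n t (mem_ballFinset.1 ht)
  · exact ext_of_map_truncate fun n hn => (hQ n hn).trans (hmap n)
  -- A finite tree with `N` vertices has an empty level `N`, so the finite trees lie in a countable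
  -- union of null sets.
  · refine measure_mono_null (fun T hT => ?_) (measure_iUnion_null hzero)
    have hfin : Finite T.Vertex := not_infinite_iff_finite.1 hT
    have hcard : T ∈ ofOrder D (Nat.card T.Vertex) := ENat.card_eq_coe_natCard T.Vertex
    exact Set.mem_iUnion.2 ⟨_, levelSize_eq_zero_of_mem_ofOrder hcard⟩
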